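/- Let $T=(T(y,x,y';z))_{y,x,y',z\in E}$ be a transition matrix from $E^3$ to $E=\{0,1\}$ (so $T\ge 0$ and $\sum_z T(y,x,y';z)=1$) with positive rate, i.e. $T(y,x,y';z)>0$ for all $y,x,y',z$. Let $A$ be the triangular probabilistic cellular automaton (TPCA) on $\mathbb Z$ with transition matrix $T$: given $S_t=(x_i)_{i\in\mathbb Z}$ and $S_{t+1}=(y_i)_{i\in\mathbb Z}$, the states $S_{t+2}(i)$, $i\in\mathbb Z$, are independent and $S_{t+2}(i)$ has law $T(y_i,x_{i+1},y_{i+1};\cdot)$. A probability measure $\mu$ on $E^{\mathbb Z}\times E^{\mathbb Z}$ is invariant if $(S_t,S_{t+1})\sim\mu$ implies $(S_{t+1},S_{t+2})\sim\mu$. For stochastic matrices $D,U$ from $E$ to $E$, a $(D,U)$-HZMC distribution is a probability measure $\mu$ on $E^{\mathbb Z}\times E^{\mathbb Z}$ for which there are probability measures $(\rho_i)_{i\in\mathbb Z}$ on $E$ with $\rho_{i+1}=\rho_i DU$ for all $i$ and, for all $k_1<k_2$ and all $x_i,y_i\in E$, $$\mu\big((x_i:k_1\le i\le k_2),(y_i:k_1\le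 i\le k_2-1)\big)=\rho_{k_1}(x_{k_1})\prod_{j=k_1}^{k_2-1}D(x_j;y_j)U(y_j;x_{j+1}).$$ For $y,y'\in E$ let $(\tilde T(y,y';x))_{x\in E}$ be the unique stochastic (nonnegative entries of sum $1$) left eigenvector, for the eigenvalue $1$, of the matrix $\big(\sum_{u}T(y',x,y;u)T(y,u,y';z)\big)_{x,z\in E}$. Let $\nu$ be the unique stochastic left eigenvector of $(\tilde T(x,x;y))_{x,y\in E}$ for the eigenvalue $1$, let $\gamma$ be the unique stochastic left eigenvector of $\Big(\nu(y)\frac{\tilde T(y,y;0)}{\tilde T(y,x;0)}\Big)_{x,y\in E}$ for its maximal eigenvalue, and set $$D^\gamma(x;y)=\frac{\sum_{x'}\gamma(x')\frac{\tilde T(x,x';y)}{\tilde T(x,x';0)}}{\sum_{x''}\frac{\gamma(x'')}{\tilde T(x,x'';0)}},\qquad U^\gamma(y;x')=\frac{\gamma(x')\frac{\tilde T(0,x';y)}{\tilde T(0,x';0)}}{\sum_{x''}\gamma(x'')\frac{\tilde T(0,x'';y)}{\tilde T(0,x'';0)}}.$$ Then these objects are well defined, and there exist stochastic matrices $D,U$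 and a $(D,U)$-HZMC distribution that is an invariant probability measure of $A$ if and only if the two following conditions hold: 1. for all $x,x',y\in E$, $\tilde T(x,x';y)\tilde T(x,0;0)\tilde T(0,x';0)\tilde T(0,0;y)=\tilde T(0,0;0)\tilde T(x,x';0)\tilde T(0,x';y)\tilde T(x,0;y)$; 2. for all $y,y',z\in E$, $D^\gamma(y;z)U^\gamma(z;y')=\sum_{x\in E}U^\gamma(y;x)D^\gamma(x;y')T(y,x,y';z)$. In this case there is exactly one $(D^\gamma,U^\gamma)$-HZMC distribution, and it is an invariant probability measure of $A$. -/

import Mathlib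

open MeasureTheory ProbabilityTheory

noncomputable section

/-- A triangular probabilistic cellular automaton (TPCA) on the lattice `ℤ` with finite alphabet `E`:
it is given by a transition matrix from `E ^ 3` to `E`. The number `T y x y' z` is the
probability that the new state of a site is `z`, when the two neighbouring states of the present
line are `y` (left) and `y'` (right), and the state of the previous line between them is `x`. -/
structure TPCA (E : Type*) [Fintype E] where
  T : E → E → E → E → ℝ
  nonneg : ∀ y x y' z, 0 ≤ T y x y' z
  sum_eq_one : ∀ y x y', ∑ z, T y x y' z = 1

namespace TPCA

/-- Positive rate: all the transition probabilities are positive. -/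
def PositiveRate {E : Type*} [Fintype E] (A : TPCA E) : Prop :=
  ∀ y x y' z, 0 < A.T y x y' z

/-- The probability measure `T(y, x, y'; ·)` on the alphabet. -/
def localLaw {E : Type*} [Fintype E] [MeasurableSpace E] (A : TPCA E) (y x y' : E) : Measure E :=
  ∑ z, ENNReal.ofReal (A.T y x y' z) • Measure.dirac z

instance {E : Type*} [Fintype E] [MeasurableSpace E] (A : TPCA E) (y x y' : E) :
    IsProbabilityMeasure (A.localLaw y x y') := by
  constructor
  simp only [localLaw, Measure.coe_finsetSum, Finset.sum_apply, Measure.smul_apply, measure_univ,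
    smul_eq_mul, mul_one]
  rw [← ENNReal.ofReal_sum_of_nonneg (fun z _ => A.nonneg y x y' z), A.sum_eq_one,
    ENNReal.ofReal_one]

/-- The law of the line `S_{t+2}` given `S_t = x` and `S_{t+1} = y`: its sites are independent, and
the site `i` has law `T(y i, x (i+1), y (i+1); ·)`. -/
def nextLine {E : Type*} [Fintype E] [MeasurableSpace E] (A : TPCA E) (p : (ℤ → E) × (ℤ → E)) :
    Measure (ℤ → E) :=
  Measure.infinitePi fun i : ℤ => A.localLaw (p.2 i) (p.1 (i + 1)) (p.2 (i + 1))

instance {E : Type*} [Fintype E] [MeasurableSpace E] (A : TPCA E) (p : (ℤ → E) × (ℤ → E)) :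
    IsProbabilityMeasure (A.nextLine p) := by
  unfold nextLine; infer_instance

theorem measurable_localLaw {E Ω : Type*} [Fintype E] [MeasurableSpace E]
    [DiscreteMeasurableSpace E] [MeasurableSpace Ω] (A : TPCA E) (u : Set E) {f g h : Ω → E}
    (hf : Measurable f) (hg : Measurable g) (hh : Measurable h) :
    Measurable fun ω => A.localLaw (f ω) (g ω) (h ω) u := by
  let F : E × E × E → ENNReal := fun q => A.localLaw q.1 q.2.1 q.2.2 u
  have hF : Measurable F := measurable_of_finite F
  have hq : Measurable fun ω => (f ω, g ω, h ω) := hf.prodMk (hg.prodMk hh)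
  have hc : Measurable fun ω => F (f ω, g ω, h ω) := Measurable.comp hF hq
  simpa only [F] using hc

theorem measurable_nextLine_pi {E : Type*} [Fintype E] [MeasurableSpace E]
    [DiscreteMeasurableSpace E] (A : TPCA E) (s : Finset ℤ) (t : ℤ → Set E) :
    Measurable fun p => A.nextLine p ((s : Set ℤ).pi t) := by
  have h : (fun p => A.nextLine p ((s : Set ℤ).pi t)) =
      fun p => ∏ i ∈ s, A.localLaw (p.2 i) (p.1 (i + 1)) (p.2 (i + 1)) (t i) := by
    funext p
    exact Measure.infinitePi_pi _ fun i _ => MeasurableSet.of_discrete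
  rw [h]
  refine Finset.measurable_fun_prod _ fun i _ => ?_
  apply A.measurable_localLaw (t i)
  · exact (measurable_pi_apply i).comp measurable_snd
  · exact (measurable_pi_apply (i + 1)).comp measurable_fst
  · exact (measurable_pi_apply (i + 1)).comp measurable_snd

theorem measurable_nextLine {E : Type*} [Fintype E] [MeasurableSpace E] [DiscreteMeasurableSpace E]
    (A : TPCA E) : Measurable A.nextLine := by
  refine Measurable.measure_of_isPiSystem_of_isProbabilityMeasure
    (generateFrom_squareCylinders (α := fun _ : ℤ => E)).symm
    (isPiSystem_squareCylinders (fun _ => MeasurableSpace.isPiSystem_measurableSet)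
      (fun _ => MeasurableSet.univ)) ?_
  intro u hu
  obtain ⟨s, t, ht, h⟩ := hu
  rw [h]
  exact A.measurable_nextLine_pi s t

/-- The Markov kernel `(S_t, S_{t+1}) ↦ (S_{t+1}, S_{t+2})` of the TPCA. -/
def step {E : Type*} [Fintype E] [MeasurableSpace E] [DiscreteMeasurableSpace E] (A : TPCA E) :
    Kernel ((ℤ → E) × (ℤ → E)) ((ℤ → E) × (ℤ → E)) :=
  (Kernel.deterministic Prod.snd measurable_snd) ×ₖ ⟨A.nextLine, A.measurable_nextLine⟩

/-- Invariant probability measures of a TPCA, on pairs of consecutive lines. -/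
def IsInvariantProbability {E : Type*} [Fintype E] [MeasurableSpace E] [DiscreteMeasurableSpace E]
    (A : TPCA E) (μ : Measure ((ℤ → E) × (ℤ → E))) : Prop :=
  IsProbabilityMeasure μ ∧ A.step.Invariant μ

/-- The matrix `(∑ u, T(y',x,y;u) T(y,u,y';z) : x, z ∈ E)`. -/
def twoStep {E : Type*} [Fintype E] (A : TPCA E) (y y' : E) : Matrix E E ℝ :=
  Matrix.of fun x z => ∑ u, A.T y' x y u * A.T y u y' z

end TPCA

/-- `μ` is a `(D, U)`-HZMC (horizontal zigzag Markov chain) distribution on pairs of lines. -/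
def IsHZMC {E : Type*} [Fintype E] [DecidableEq E] [MeasurableSpace E] (D U : Matrix E E ℝ)
    (μ : Measure ((ℤ → E) × (ℤ → E))) : Prop :=
  IsProbabilityMeasure μ ∧
  D ∈ Matrix.rowStochastic ℝ E ∧ U ∈ Matrix.rowStochastic ℝ E ∧
  ∃ ρ : ℤ → E → ℝ, (∀ i, ρ i ∈ stdSimplex ℝ E) ∧
    (∀ k₁ k₂ : ℤ, k₁ < k₂ → ∀ x y : ℤ → E,
      μ {p | (∀ i, k₁ ≤ i → i ≤ k₂ → p.1 i = x i) ∧ (∀ i, k₁ ≤ i → i ≤ k₂ - 1 → p.2 i = y i)} =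
        ENNReal.ofReal (ρ k₁ (x k₁) *
          ∏ j ∈ Finset.Icc k₁ (k₂ - 1), D (x j) (y j) * U (y j) (x (j + 1)))) ∧
    ∀ (i : ℤ) (x' : E), ρ (i + 1) x' = ∑ x, ρ i x * ∑ y, D x y * U y x'

/-- `v` is a stochastic left eigenvector of `M` associated with `a`. -/
def IsStochasticLeftEigenvector {E : Type*} [Fintype E] (M : Matrix E E ℝ) (a : ℝ) (v : E → ℝ) :
    Prop :=
  v ∈ stdSimplex ℝ E ∧ Matrix.vecMul v M = a • v

/-- `v` is the only stochastic left eigenvector of `M` associated with `a`. -/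
def IsTheStochasticLeftEigenvector {E : Type*} [Fintype E] (M : Matrix E E ℝ) (a : ℝ)
    (v : E → ℝ) : Prop :=
  IsStochasticLeftEigenvector M a v ∧ ∀ w, IsStochasticLeftEigenvector M a w → w = v

namespace SquarePCA

/-! In this namespace, `T x x' y` is the entry `T(x,x';y)` of a transition kernel from `E ^ 2` to
`E` with positive coefficients, and `0` is a distinguished letter of the alphabet. -/

/-- The matrix `(T(x,x;y) : x, y ∈ E)`. -/
def diagMatrix {E : Type*} (T : E → E → E → ℝ) : Matrix E E ℝ :=
  Matrix.of fun x y => T x x y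

/-- The matrix `(ν(y) T(y,y;0) / T(y,x;0) : x, y ∈ E)`. -/
def gammaMatrix {E : Type*} [Zero E] (T : E → E → E → ℝ) (ν : E → ℝ) : Matrix E E ℝ :=
  Matrix.of fun x y => ν y * (T y y 0 / T y x 0)

/-- `γ` is the vector attached to `T`: with `ν` the stochastic left eigenvector of `(T(x,x;y))` for
the eigenvalue `1`, it is the stochastic left eigenvector of `gammaMatrix T ν` for the maximal
eigenvalue of that matrix. -/
def IsGamma {E : Type*} [Fintype E] [DecidableEq E] [Zero E] (T : E → E → E → ℝ) (γ : E → ℝ) :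
    Prop :=
  ∃ (ν : E → ℝ) (lam : ℝ),
    IsTheStochasticLeftEigenvector (diagMatrix T) 1 ν ∧
    IsGreatest (spectrum ℝ (gammaMatrix T ν)) lam ∧
    IsTheStochasticLeftEigenvector (gammaMatrix T ν) lam γ

/-- The matrix `D^η`. -/
def matD {E : Type*} [Fintype E] [Zero E] (T : E → E → E → ℝ) (η : E → ℝ) : Matrix E E ℝ :=
  Matrix.of fun x y => (∑ x', η x' * (T x x' y / T x x' 0)) / ∑ x'', η x'' / T x x'' 0

/-- The matrix `U^η`. -/
def matU {E : Type*} [Fintype E] [Zero E] (T : E → E → E → ℝ) (η : E → ℝ) : Matrix E E ℝ :=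
  Matrix.of fun y x' =>
    (η x' * (T 0 x' y / T 0 x' 0)) / ∑ x'', η x'' * (T 0 x'' y / T 0 x'' 0)

/-- The first condition for a square PCA to have an invariant HZMC distribution. -/
def CondOne {E : Type*} [Zero E] (T : E → E → E → ℝ) : Prop :=
  ∀ x x' y, T x x' y * T x 0 0 * T 0 x' 0 * T 0 0 y = T 0 0 0 * T x x' 0 * T 0 x' y * T x 0 y

end SquarePCA

/-- The relation `D(y;z) U(z;y') = ∑ x, U(y;x) D(x;y') T(y,x,y';z)`. -/
def CondTPCA {E : Type*} [Fintype E] (A : TPCA E) (D U : Matrix E E ℝ) : Prop :=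
  ∀ y y' z, D y z * U z y' = ∑ x, U y x * D x y' * A.T y x y' z

end

/-! Write T̃ for the kernel `Tt`. The proof reduces invariance of a zigzag chain to the local
identity `CondTPCA`, and then shows that this identity determines `D` and `U` from T̃.

Necessity. Comparing μ with its image on the smallest window (`local_balance_of_invariant`) and
summing out the new letters gives ρ₀D = ρ₀. Positive rate then spreads positivity to ρ₀, `D` and
`U`, and `CondTPCA` follows (`pos_of_hzmc_invariant`). Summing `CondTPCA` over the new letter gives
DU = UD. Commuting positive stochastic matrices share their stationary law ρ, and on two letters
every stationary chain is reversible, so ρ is reversible for both `D` and `U`. With this symmetry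
`CondTPCA` also describes the move backwards, and D(y;x)U(x;y')/(DU)(y,y') is preserved by the
two-step matrix. By uniqueness it equals T̃(y,y';x). The first condition is then an algebraic
identity. Moreover ν is the normalised diagonal of DU, and U(0;·) is a positive left eigenvector of
the γ-matrix with eigenvalue 1/tr(DU). Perron uniqueness gives γ = U(0;·), and cancelling
normalisations yields D^γ = D and U^γ = U.

Sufficiency. D^γ and U^γ are positive and stochastic, and under `CondTPCA` they commute, hence have
a common reversible law ρ. The stationary zigzag chain started from ρ exists
(`Zigzag.exists_measure`) and is invariant, because `CondTPCA` turns each factor of the image law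
into the right one. It is the only HZMC distribution for these matrices: a two-sided sequence of
laws driven by the contraction DU must be constant (`eq_of_recursion_fin_two`). -/

noncomputable section

/-! ### Positive matrices of size two -/

theorem isStochasticLeftEigenvector_fin_two_iff (M : Matrix (Fin 2) (Fin 2) ℝ) (a : ℝ)
    (v : Fin 2 → ℝ) :
    IsStochasticLeftEigenvector M a v ↔ (0 ≤ v 0 ∧ 0 ≤ v 1 ∧ v 0 + v 1 = 1) ∧
      v 0 * M 0 0 + v 1 * M 1 0 = a * v 0 ∧ v 0 * M 0 1 + v 1 * M 1 1 = a * v 1 := by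
  simp [IsStochasticLeftEigenvector, stdSimplex, funext_iff, Fin.forall_fin_two,
    Matrix.vecMul, dotProduct, Fin.sum_univ_two, and_assoc]

theorem mem_spectrum_fin_two_iff (M : Matrix (Fin 2) (Fin 2) ℝ) (a : ℝ) :
    a ∈ spectrum ℝ M ↔ (a - M 0 0) * (a - M 1 1) = M 0 1 * M 1 0 := by
  rw [spectrum.mem_iff, Matrix.isUnit_iff_isUnit_det, isUnit_iff_ne_zero, not_not,
    Matrix.det_fin_two]
  simp only [Matrix.sub_apply, Matrix.algebraMap_matrix_apply]
  norm_num
  exact sub_eq_zero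

/-- The Perron theorem for positive matrices of size two. -/
theorem exists_perron_fin_two (M : Matrix (Fin 2) (Fin 2) ℝ) (hM : ∀ i j, 0 < M i j) :
    ∃ (lam : ℝ) (v : Fin 2 → ℝ), IsGreatest (spectrum ℝ M) lam ∧ (∀ i, 0 < v i) ∧
      IsStochasticLeftEigenvector M lam v ∧
      ∀ a w, IsStochasticLeftEigenvector M a w → a = lam ∧ w = v := by
  have ha := hM 0 0
  have hb := hM 0 1
  have hc := hM 1 0
  have hd := hM 1 1
  have hbc : 0 < M 0 1 * M 1 0 := mul_pos hb hc
  set s := Real.sqrt ((M 0 0 - M 1 1) ^ 2 + 4 * (M 0 1 * M 1 0)) with hs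
  have hs2 : s ^ 2 = (M 0 0 - M 1 1) ^ 2 + 4 * (M 0 1 * M 1 0) := Real.sq_sqrt (by positivity)
  have hs3 : |M 0 0 - M 1 1| < s := by
    apply Real.lt_sqrt_of_sq_lt
    rw [sq_abs]; linarith
  obtain ⟨h1, h2⟩ := abs_lt.1 hs3
  -- The larger root of the characteristic polynomial; it exceeds both diagonal entries because the
  -- off-diagonal product is positive.
  obtain ⟨lam, hlam⟩ : ∃ lam : ℝ, lam = (M 0 0 + M 1 1 + s) / 2 := ⟨_, rfl⟩
  have hla : M 0 0 < lam := by linarith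
  have hld : M 1 1 < lam := by linarith
  have heq : (lam - M 0 0) * (lam - M 1 1) = M 0 1 * M 1 0 := by
    rw [hlam]; linear_combination hs2 / 4
  have hle : ∀ x, (x - M 0 0) * (x - M 1 1) = M 0 1 * M 1 0 → x ≤ lam := by
    intro x hx
    by_contra! h
    have := mul_lt_mul'' (sub_lt_sub_right h (M 0 0)) (sub_lt_sub_right h (M 1 1))
      (by linarith) (by linarith)
    linarith
  have hp : 0 < M 1 0 + (lam - M 0 0) := by linarith
  -- Uniqueness ranges over all eigenvalues: a nonnegative eigenvector has positive coordinates, so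
  -- its eigenvalue exceeds both diagonal entries, where (x - M 0 0)(x - M 1 1) is strictly
  -- increasing and takes the required value only once.
  have huniq : ∀ a w, IsStochasticLeftEigenvector M a w → a = lam ∧
      w = ![M 1 0 / (M 1 0 + (lam - M 0 0)), (lam - M 0 0) / (M 1 0 + (lam - M 0 0))] := by
    intro a w h
    rw [isStochasticLeftEigenvector_fin_two_iff] at h
    obtain ⟨⟨h0, h1, hsum⟩, e0, e1⟩ := h
    have w0 : 0 < w 0 := by
      rcases h0.eq_or_lt with h | h
      · rw [← h] at hsum e0
        have : w 1 = 1 := by linarith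
        rw [this] at e0
        linarith
      · exact h
    have w1 : 0 < w 1 := by
      rcases h1.eq_or_lt with h | h
      · rw [← h] at hsum e1
        have : w 0 = 1 := by linarith
        rw [this] at e1
        linarith
      · exact h
    have ha0 : M 0 0 < a := by
      have := mul_pos w1 hc
      by_contra! hh
      nlinarith
    have ha1 : M 1 1 < a := by
      have := mul_pos w0 hb
      by_contra! hh
      nlinarith
    have hchar : (a - M 0 0) * (a - M 1 1) = M 0 1 * M 1 0 := by
      have : w 0 * w 1 * ((a - M 0 0) * (a - M 1 1) - M 0 1 * M 1 0) = 0 := by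
        have f0 : w 1 * M 1 0 = (a - M 0 0) * w 0 := by linarith
        have f1 : w 0 * M 0 1 = (a - M 1 1) * w 1 := by linarith
        linear_combination (-(w 0 * M 0 1)) * f0 - (a - M 0 0) * w 0 * f1
      rcases mul_eq_zero.1 this with h | h
      · exact absurd h (mul_pos w0 w1).ne'
      · linarith
    have hal : a = lam := by
      refine le_antisymm (hle a hchar) ?_
      by_contra! h
      have := mul_lt_mul'' (sub_lt_sub_right h (M 0 0)) (sub_lt_sub_right h (M 1 1))
        (by linarith) (by linarith)
      linarith
    rw [hal] at e0
    refine ⟨hal, funext fun i => ?_⟩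
    have hw1 : w 1 = 1 - w 0 := by linarith
    rw [hw1] at e0
    fin_cases i
    · simp only [Fin.zero_eta, Matrix.cons_val_zero]
      rw [eq_div_iff hp.ne']; linarith
    · change w 1 = (lam - M 0 0) / (M 1 0 + (lam - M 0 0))
      rw [eq_div_iff hp.ne', hw1]; linarith
  refine ⟨lam, _, ⟨(mem_spectrum_fin_two_iff M lam).2 heq,
    fun x hx => hle x ((mem_spectrum_fin_two_iff M x).1 hx)⟩, ?_, ?_, huniq⟩
  · intro i
    fin_cases i
    · exact div_pos hc hp
    · exact div_pos (by linarith) hp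
  · rw [isStochasticLeftEigenvector_fin_two_iff]
    simp only [Matrix.cons_val_zero, Matrix.cons_val_one]
    refine ⟨⟨(div_pos hc hp).le, (div_pos (by linarith) hp).le, ?_⟩, ?_, ?_⟩
    · field_simp
    · field_simp; ring
    · field_simp
      linear_combination -heq

theorem IsStochasticLeftEigenvector.eigenvalue_eq_one {E : Type*} [Fintype E] {M : Matrix E E ℝ}
    {a : ℝ} {v : E → ℝ} (h : IsStochasticLeftEigenvector M a v) (hM : ∀ i, ∑ j, M i j = 1) :
    a = 1 := by
  have h1 := congrArg (fun w => ∑ j, w j) h.2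
  simp only [Matrix.vecMul, dotProduct, Pi.smul_apply, smul_eq_mul] at h1
  rw [Finset.sum_comm, ← Finset.mul_sum, h.1.2] at h1
  simp_rw [← Finset.mul_sum, hM, mul_one, h.1.2] at h1
  linarith

theorem exists_stationary_fin_two (M : Matrix (Fin 2) (Fin 2) ℝ) (hM : ∀ i j, 0 < M i j)
    (h1 : ∀ i, ∑ j, M i j = 1) :
    ∃ v : Fin 2 → ℝ, (∀ i, 0 < v i) ∧ IsTheStochasticLeftEigenvector M 1 v := by
  obtain ⟨lam, v, -, hv, hE, hu⟩ := exists_perron_fin_two M hM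
  obtain rfl := hE.eigenvalue_eq_one h1
  exact ⟨v, hv, hE, fun w hw => (hu 1 w hw).2⟩

/-! ### Products over integer intervals and splitting a measure over finitely many values -/

theorem Finset.prod_Icc_int_right {M : Type*} [CommMonoid M] (f : ℤ → M) {a b : ℤ} (h : a ≤ b) :
    ∏ j ∈ Finset.Icc a b, f j = (∏ j ∈ Finset.Icc a (b - 1), f j) * f b := by
  have : Finset.Icc a b = insert b (Finset.Icc a (b - 1)) := by
    ext i; simp only [Finset.mem_Icc, Finset.mem_insert]; omega
  rw [this, Finset.prod_insert (by simp), mul_comm]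

theorem Finset.prod_Icc_int_left {M : Type*} [CommMonoid M] (f : ℤ → M) {a b : ℤ} (h : a ≤ b) :
    ∏ j ∈ Finset.Icc a b, f j = f a * ∏ j ∈ Finset.Icc (a + 1) b, f j := by
  have : Finset.Icc a b = insert a (Finset.Icc (a + 1) b) := by
    ext i; simp only [Finset.mem_Icc, Finset.mem_insert]; omega
  rw [this, Finset.prod_insert (by simp)]

theorem MeasureTheory.measure_eq_sum_inter_preimage_singleton {Ω F : Type*} [MeasurableSpace Ω]
    [Fintype F] [MeasurableSpace F] [MeasurableSingletonClass F] (μ : Measure Ω) {f : Ω → F}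
    (hf : Measurable f) (s : Set Ω) : μ s = ∑ a, μ (f ⁻¹' {a} ∩ s) := by
  have h := sum_measure_preimage_singleton (μ := μ.restrict s) (f := f) Finset.univ
    (fun y _ => hf (measurableSet_singleton y))
  simp only [Finset.coe_univ, Set.preimage_univ, Measure.restrict_apply MeasurableSet.univ,
    Set.univ_inter] at h
  rw [← h]
  exact Finset.sum_congr rfl fun a _ =>
    Measure.restrict_apply (hf (measurableSet_singleton a))

/-! ### Cylinders along a zigzag -/

section Cylinder

variable {E : Type*}

/-- The pairs of lines that agree with `x`, `y` along the zigzag from `x k₁` to `x k₂`. -/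
def zigzagCylinder (k₁ k₂ : ℤ) (x y : ℤ → E) : Set ((ℤ → E) × (ℤ → E)) :=
  {p | (∀ i, k₁ ≤ i → i ≤ k₂ → p.1 i = x i) ∧ (∀ i, k₁ ≤ i → i ≤ k₂ - 1 → p.2 i = y i)}

/-- The pairs of lines that agree with `x`, `y` along the zigzag from `y k₁` to `y k₂`. -/
def lowerCylinder (k₁ k₂ : ℤ) (x y : ℤ → E) : Set ((ℤ → E) × (ℤ → E)) :=
  {p | (∀ i, k₁ ≤ i → i ≤ k₂ - 1 → p.1 (i + 1) = x (i + 1)) ∧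
    (∀ i, k₁ ≤ i → i ≤ k₂ → p.2 i = y i)}

theorem zigzagCylinder_eq_prod (k₁ k₂ : ℤ) (x y : ℤ → E) : zigzagCylinder k₁ k₂ x y =
    {v : ℤ → E | ∀ i, k₁ ≤ i → i ≤ k₂ → v i = x i} ×ˢ
      (((Finset.Icc k₁ (k₂ - 1) : Finset ℤ) : Set ℤ).pi fun i => {y i}) := by
  ext p; simp [zigzagCylinder, Set.mem_pi]

variable [MeasurableSpace E] [DiscreteMeasurableSpace E]

theorem measurableSet_eqOn (k₁ k₂ : ℤ) (x : ℤ → E) :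
    MeasurableSet {v : ℤ → E | ∀ i, k₁ ≤ i → i ≤ k₂ → v i = x i} := by
  have : {v : ℤ → E | ∀ i, k₁ ≤ i → i ≤ k₂ → v i = x i} =
      ((Finset.Icc k₁ k₂ : Finset ℤ) : Set ℤ).pi fun i => {x i} := by
    ext v; simp [Set.mem_pi]
  rw [this]
  exact MeasurableSet.pi (Finset.countable_toSet _) fun i _ => measurableSet_singleton _

theorem measurableSet_zigzagCylinder (k₁ k₂ : ℤ) (x y : ℤ → E) :
    MeasurableSet (zigzagCylinder k₁ k₂ x y) :=
  ((measurableSet_eqOn k₁ k₂ x).preimage measurable_fst).inter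
    ((measurableSet_eqOn k₁ (k₂ - 1) y).preimage measurable_snd)

/-- A pair of lines is one line over `E × E`, so the finite-dimensional marginals decide. Every
finite set of sites lies in some [-N, N], and its marginal factors through a zigzag window around
the origin. -/
theorem ext_of_zigzagCylinder [Fintype E] {μ ν : Measure ((ℤ → E) × (ℤ → E))} [IsFiniteMeasure μ]
    [IsFiniteMeasure ν] (h : ∀ k₁ k₂ : ℤ, k₁ < k₂ → ∀ x y : ℤ → E,
      μ (zigzagCylinder k₁ k₂ x y) = ν (zigzagCylinder k₁ k₂ x y)) : μ = ν := by
  classical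
  let e := (MeasurableEquiv.arrowProdEquivProdArrow E E ℤ).symm
  suffices hs : μ.map e = ν.map e by
    have := congrArg (Measure.map e.symm) hs
    rwa [e.map_symm_map, e.map_symm_map] at this
  have : IsFiniteMeasure (μ.map e) := inferInstance
  have : IsFiniteMeasure (ν.map e) := inferInstance
  refine IsProjectiveLimit.unique (P := fun I => (ν.map e).map I.restrict) ?_ (fun I => rfl)
  intro I
  change _ = (ν.map e).map I.restrict
  obtain ⟨N, hN⟩ : ∃ N : ℕ, ∀ i ∈ I, i ∈ Finset.Icc (-(N : ℤ)) N := by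
    refine ⟨I.sup Int.natAbs, fun i hi => ?_⟩
    have := Finset.le_sup (f := Int.natAbs) hi
    rw [Finset.mem_Icc]; omega
  have hN1 : ∀ i ∈ I, i ∈ Finset.Icc (-(N : ℤ)) (N + 1) := fun i hi => by
    have := hN i hi
    rw [Finset.mem_Icc] at *; omega
  -- The upper window has one more site than the lower one, so that the fibres of `r` are exactly
  -- zigzag cylinders.
  let r : (ℤ → E) × (ℤ → E) →
      ((Finset.Icc (-(N : ℤ)) (N + 1) : Finset ℤ) → E) ×
        ((Finset.Icc (-(N : ℤ)) N : Finset ℤ) → E) :=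
    fun p => (fun i => p.1 i, fun i => p.2 i)
  have hr : Measurable r := by fun_prop
  let g : ((Finset.Icc (-(N : ℤ)) (N + 1) : Finset ℤ) → E) ×
      ((Finset.Icc (-(N : ℤ)) N : Finset ℤ) → E) →
      (I → E × E) := fun q i => (q.1 ⟨i, hN1 i i.2⟩, q.2 ⟨i, hN i i.2⟩)
  have hg : Measurable g := by fun_prop
  have hcomp : (I.restrict (π := fun _ : ℤ => E × E)) ∘ e = g ∘ r := rfl
  have hmap : μ.map r = ν.map r := by
    refine Measure.ext_of_singleton fun v => ?_
    rw [Measure.map_apply hr (measurableSet_singleton v),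
      Measure.map_apply hr (measurableSet_singleton v)]
    by_cases hv : (r ⁻¹' {v}).Nonempty
    · obtain ⟨p, rfl⟩ := hv
      have : r ⁻¹' {r p} = zigzagCylinder (-(N : ℤ)) (N + 1) p.1 p.2 := by
        ext q
        simp [r, zigzagCylinder, funext_iff]
      rw [this]
      exact h _ _ (by omega) _ _
    · rw [Set.not_nonempty_iff_eq_empty.1 hv, measure_empty, measure_empty]
  rw [Measure.map_map (by fun_prop) e.measurable, Measure.map_map (by fun_prop) e.measurable, hcomp,
    ← Measure.map_map hg hr, hmap, Measure.map_map hg hr]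

end Cylinder

/-! ### Image of a zigzag chain under one step of the automaton -/

theorem TPCA.localLaw_singleton {E : Type*} [Fintype E] [MeasurableSpace E]
    [DiscreteMeasurableSpace E] (A : TPCA E) (y x y' z : E) :
    A.localLaw y x y' {z} = ENNReal.ofReal (A.T y x y' z) := by
  classical
  simp [TPCA.localLaw, Measure.coe_finsetSum, Set.indicator_apply]

instance {E : Type*} [Fintype E] [MeasurableSpace E] [DiscreteMeasurableSpace E] (A : TPCA E) :
    IsMarkovKernel (⟨A.nextLine, A.measurable_nextLine⟩ : Kernel ((ℤ → E) × (ℤ → E)) (ℤ → E)) :=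
  ⟨fun p => inferInstanceAs (IsProbabilityMeasure (A.nextLine p))⟩

instance {E : Type*} [Fintype E] [MeasurableSpace E] [DiscreteMeasurableSpace E] (A : TPCA E) :
    IsMarkovKernel A.step := by
  unfold TPCA.step; infer_instance

theorem TPCA.step_zigzagCylinder {E : Type*} [Fintype E] [MeasurableSpace E]
    [DiscreteMeasurableSpace E] (A : TPCA E) (k₁ k₂ : ℤ) (y z : ℤ → E)
    (p : (ℤ → E) × (ℤ → E)) :
    A.step p (zigzagCylinder k₁ k₂ y z) =
      Set.indicator {p : (ℤ → E) × (ℤ → E) | ∀ i, k₁ ≤ i → i ≤ k₂ → p.2 i = y i} (fun p =>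
        ∏ j ∈ Finset.Icc k₁ (k₂ - 1),
          ENNReal.ofReal (A.T (y j) (p.1 (j + 1)) (y (j + 1)) (z j))) p := by
  have hS := measurableSet_eqOn k₁ k₂ y
  rw [zigzagCylinder_eq_prod, TPCA.step, Kernel.prod_apply, Measure.prod_prod,
    Kernel.deterministic_apply, Measure.dirac_apply' _ hS]
  change _ * A.nextLine p _ = _
  rw [TPCA.nextLine, Measure.infinitePi_pi _ (fun i _ => measurableSet_singleton _)]
  simp only [TPCA.localLaw_singleton]
  by_cases hp : ∀ i, k₁ ≤ i → i ≤ k₂ → p.2 i = y i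
  · rw [Set.indicator_of_mem (by exact hp), Set.indicator_of_mem (by exact hp), Pi.one_apply,
      one_mul]
    refine Finset.prod_congr rfl fun j hj => ?_
    rw [Finset.mem_Icc] at hj
    rw [hp j hj.1 (by omega), hp (j + 1) (by omega) (by omega)]
  · rw [Set.indicator_of_notMem (by exact hp), Set.indicator_of_notMem (by exact hp), zero_mul]

section Law

/-- Regroups the same path by lower letters, peeling off the first `D` and the last `U`. -/
theorem zigzag_prod_eq {E : Type*} (D U : Matrix E E ℝ) (x y : ℤ → E) {k₁ k₂ : ℤ} (h : k₁ ≤ k₂) :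
    ∏ j ∈ Finset.Icc k₁ k₂, D (x j) (y j) * U (y j) (x (j + 1)) =
      D (x k₁) (y k₁) *
        (∏ j ∈ Finset.Icc k₁ (k₂ - 1), U (y j) (x (j + 1)) * D (x (j + 1)) (y (j + 1))) *
        U (y k₂) (x (k₂ + 1)) := by
  induction k₂, h using Int.leInduction with
  | base => simp
  | succ n hn ih =>
    rw [Finset.prod_Icc_int_right _ (by omega), add_sub_cancel_right, ih,
      Finset.prod_Icc_int_right _ hn]
    ring

variable {E : Type*} [Fintype E] [DecidableEq E] [MeasurableSpace E] [DiscreteMeasurableSpace E]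
  {D U : Matrix E E ℝ} {ρ : ℤ → E → ℝ} {μ : Measure ((ℤ → E) × (ℤ → E))}
  (hD : D ∈ Matrix.rowStochastic ℝ E) (hU : U ∈ Matrix.rowStochastic ℝ E)
  (hρ : ∀ i, ρ i ∈ stdSimplex ℝ E)
  (hμ : ∀ k₁ k₂ : ℤ, k₁ < k₂ → ∀ x y : ℤ → E, μ (zigzagCylinder k₁ k₂ x y) =
    ENNReal.ofReal (ρ k₁ (x k₁) *
      ∏ j ∈ Finset.Icc k₁ (k₂ - 1), D (x j) (y j) * U (y j) (x (j + 1))))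

include hD hU hρ hμ

theorem measure_lowerCylinder {k₁ k₂ : ℤ} (h : k₁ ≤ k₂) (x y : ℤ → E) :
    μ (lowerCylinder k₁ k₂ x y) = ENNReal.ofReal ((∑ a, ρ k₁ a * D a (y k₁)) *
      ∏ j ∈ Finset.Icc k₁ (k₂ - 1), U (y j) (x (j + 1)) * D (x (j + 1)) (y (j + 1))) := by
  have hDn := fun i j => Matrix.nonneg_of_mem_rowStochastic hD (i := i) (j := j)
  have hUn := fun i j => Matrix.nonneg_of_mem_rowStochastic hU (i := i) (j := j)
  let f : (ℤ → E) × (ℤ → E) → E × E := fun p => (p.1 k₁, p.1 (k₂ + 1))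
  have hf : Measurable f := by fun_prop
  rw [measure_eq_sum_inter_preimage_singleton μ hf]
  have key : ∀ a : E × E, μ (f ⁻¹' {a} ∩ lowerCylinder k₁ k₂ x y) =
      ENNReal.ofReal (ρ k₁ a.1 * (D a.1 (y k₁) * (∏ j ∈ Finset.Icc k₁ (k₂ - 1),
        U (y j) (x (j + 1)) * D (x (j + 1)) (y (j + 1))) * U (y k₂) a.2)) := by
    intro a
    -- The lower cylinder leaves the two end letters of the upper line free. Prescribing them gives
    -- a zigzag cylinder; summing over them leaves ρD on the left and 1 on the right.
    set x' : ℤ → E := Function.update (Function.update x k₁ a.1) (k₂ + 1) a.2 with hx'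
    have e1 : x' k₁ = a.1 := by
      rw [hx', Function.update_of_ne (by omega), Function.update_self]
    have e2 : x' (k₂ + 1) = a.2 := by rw [hx', Function.update_self]
    have e3 : ∀ j, k₁ ≤ j → j ≤ k₂ - 1 → x' (j + 1) = x (j + 1) := fun j h1 h2 => by
      rw [hx', Function.update_of_ne (by omega), Function.update_of_ne (by omega)]
    have hset : f ⁻¹' {a} ∩ lowerCylinder k₁ k₂ x y = zigzagCylinder k₁ (k₂ + 1) x' y := by
      ext p
      simp only [f, lowerCylinder, zigzagCylinder, Set.mem_inter_iff, Set.mem_preimage,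
        Set.mem_singleton_iff, Set.mem_ofPred_eq, add_sub_cancel_right, Prod.ext_iff]
      constructor
      · rintro ⟨⟨h1, h2⟩, h3, h4⟩
        refine ⟨fun i hi hi' => ?_, h4⟩
        rcases hi.eq_or_lt with rfl | hi
        · rw [e1, h1]
        rcases hi'.eq_or_lt with rfl | hi'
        · rw [e2, h2]
        · have := h3 (i - 1) (by omega) (by omega)
          have h5 := e3 (i - 1) (by omega) (by omega)
          rw [sub_add_cancel] at this h5
          rw [this, h5]
      · rintro ⟨h1, h2⟩
        refine ⟨⟨?_, ?_⟩, fun i hi hi' => ?_, h2⟩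
        · rw [← e1]; exact h1 _ le_rfl (by omega)
        · rw [← e2]; exact h1 _ (by omega) le_rfl
        · rw [← e3 i hi hi']; exact h1 _ (by omega) (by omega)
    rw [hset, hμ _ _ (by omega), add_sub_cancel_right, zigzag_prod_eq D U x' y h, e1, e2]
    congr 4
    refine Finset.prod_congr rfl fun j hj => ?_
    rw [Finset.mem_Icc] at hj
    rw [e3 j hj.1 hj.2]
  have hP : 0 ≤ ∏ j ∈ Finset.Icc k₁ (k₂ - 1), U (y j) (x (j + 1)) * D (x (j + 1)) (y (j + 1)) :=
    Finset.prod_nonneg fun j _ => mul_nonneg (hUn _ _) (hDn _ _)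
  rw [Finset.sum_congr rfl fun a _ => key a, ← ENNReal.ofReal_sum_of_nonneg fun a _ =>
    mul_nonneg ((hρ k₁).1 _) (mul_nonneg (mul_nonneg (hDn _ _) hP) (hUn _ _)),
    Fintype.sum_prod_type]
  congr 1
  rw [Finset.sum_mul]
  refine Finset.sum_congr rfl fun a _ => ?_
  simp only
  rw [← Finset.mul_sum, ← Finset.mul_sum, Matrix.sum_row_of_mem_rowStochastic hU]
  ring

theorem bind_step_zigzagCylinder (A : TPCA E) {k₁ k₂ : ℤ} (h : k₁ ≤ k₂) (y z : ℤ → E) :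
    (μ.bind A.step) (zigzagCylinder k₁ k₂ y z) = ENNReal.ofReal ((∑ a, ρ k₁ a * D a (y k₁)) *
      ∏ j ∈ Finset.Icc k₁ (k₂ - 1),
        ∑ a, U (y j) a * D a (y (j + 1)) * A.T (y j) a (y (j + 1)) (z j)) := by
  have hDn := fun i j => Matrix.nonneg_of_mem_rowStochastic hD (i := i) (j := j)
  have hUn := fun i j => Matrix.nonneg_of_mem_rowStochastic hU (i := i) (j := j)
  have hS : MeasurableSet {p : (ℤ → E) × (ℤ → E) | ∀ i, k₁ ≤ i → i ≤ k₂ → p.2 i = y i} :=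
    (measurableSet_eqOn k₁ k₂ y).preimage measurable_snd
  -- The integrand depends only on the upper letters strictly inside the window, so the integral
  -- becomes a finite sum over `I → E`, later refactored as a product of sums over single letters.
  let I := Finset.Icc k₁ (k₂ - 1)
  let r : (ℤ → E) × (ℤ → E) → (I → E) := fun p j => p.1 (j + 1)
  have hr : Measurable r := by fun_prop
  let g : (I → E) → ENNReal :=
    fun w => ∏ j : I, ENNReal.ofReal (A.T (y j) (w j) (y (j + 1)) (z j))
  have hg : Measurable g := measurable_of_finite g
  have hgr : ∀ p : (ℤ → E) × (ℤ → E), ∏ j ∈ Finset.Icc k₁ (k₂ - 1),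
      ENNReal.ofReal (A.T (y j) (p.1 (j + 1)) (y (j + 1)) (z j)) = g (r p) := fun p =>
    (Finset.prod_coe_sort I
      (fun j => ENNReal.ofReal (A.T (y j) (p.1 (j + 1)) (y (j + 1)) (z j)))).symm
  rw [Measure.bind_apply (measurableSet_zigzagCylinder _ _ _ _) A.step.aemeasurable]
  simp only [A.step_zigzagCylinder, hgr]
  rw [lintegral_indicator hS, ← lintegral_map hg hr, lintegral_fintype]
  have hc : 0 ≤ ∑ a, ρ k₁ a * D a (y k₁) :=
    Finset.sum_nonneg fun a _ => mul_nonneg ((hρ k₁).1 a) (hDn _ _)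
  have key : ∀ w : I → E, g w *
      ((μ.restrict {p : (ℤ → E) × (ℤ → E) | ∀ i, k₁ ≤ i → i ≤ k₂ → p.2 i = y i}).map r) {w} =
      ENNReal.ofReal ((∑ a, ρ k₁ a * D a (y k₁)) * ∏ j : I,
        U (y j) (w j) * D (w j) (y (j + 1)) * A.T (y j) (w j) (y (j + 1)) (z j)) := by
    intro w
    -- The default `y 0` is harmless: the cylinder reads `x` only at sites `j + 1` with `j` in `I`.
    let x : ℤ → E := fun i => if hi : i - 1 ∈ I then w ⟨i - 1, hi⟩ else y 0
    have hx : ∀ j : I, x (j + 1) = w j := by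
      rintro ⟨j, hj⟩
      have : j + 1 - 1 = j := by omega
      simp only [x, this, dif_pos hj]
    have hset : r ⁻¹' {w} ∩ {p : (ℤ → E) × (ℤ → E) | ∀ i, k₁ ≤ i → i ≤ k₂ → p.2 i = y i} =
        lowerCylinder k₁ k₂ x y := by
      ext p
      simp only [lowerCylinder, Set.mem_inter_iff, Set.mem_preimage, Set.mem_singleton_iff,
        Set.mem_ofPred_eq, r, funext_iff]
      refine and_congr_left fun _ => ⟨fun hp i hi hi' => ?_, fun hp j => ?_⟩
      · have := hp ⟨i, Finset.mem_Icc.2 ⟨hi, hi'⟩⟩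
        rw [← hx] at this
        exact this
      · rw [← hx]
        exact hp j (Finset.mem_Icc.1 j.2).1 (Finset.mem_Icc.1 j.2).2
    have hgw : g w = ∏ j : I, ENNReal.ofReal (A.T (y j) (w j) (y (j + 1)) (z j)) := rfl
    rw [Measure.map_apply hr (measurableSet_singleton w),
      Measure.restrict_apply (hr (measurableSet_singleton w)), hset,
      measure_lowerCylinder hD hU hρ hμ h, hgw, ← Finset.prod_coe_sort (Finset.Icc k₁ (k₂ - 1)),
      ← ENNReal.ofReal_prod_of_nonneg fun j _ => A.nonneg _ _ _ _,
      ← ENNReal.ofReal_mul (Finset.prod_nonneg fun j _ => A.nonneg _ _ _ _)]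
    congr 1
    rw [mul_left_comm, ← Finset.prod_mul_distrib]
    congr 1
    refine Finset.prod_congr rfl fun j _ => ?_
    rw [hx j]
    ring
  rw [Finset.sum_congr rfl fun w _ => key w, ← ENNReal.ofReal_sum_of_nonneg fun w _ =>
    mul_nonneg hc (Finset.prod_nonneg fun j _ =>
      mul_nonneg (mul_nonneg (hUn _ _) (hDn _ _)) (A.nonneg _ _ _ _)),
    ← Finset.mul_sum, ← Finset.prod_coe_sort (Finset.Icc k₁ (k₂ - 1)), Finset.prod_univ_sum,
    Fintype.piFinset_univ]

end Law

/-! ### Existence of the stationary zigzag chain -/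

/-- The probability measure with weights `w` on a finite type. -/
def weightMeasure {F : Type*} [Fintype F] [MeasurableSpace F] (w : F → ℝ) : Measure F :=
  ∑ z, ENNReal.ofReal (w z) • Measure.dirac z

theorem isProbabilityMeasure_weightMeasure {F : Type*} [Fintype F] [MeasurableSpace F] {w : F → ℝ}
    (hw : w ∈ stdSimplex ℝ F) : IsProbabilityMeasure (weightMeasure w) := by
  constructor
  simp only [weightMeasure, Measure.coe_finsetSum, Finset.sum_apply, Measure.smul_apply,
    measure_univ, smul_eq_mul, mul_one]
  rw [← ENNReal.ofReal_sum_of_nonneg (fun z _ => hw.1 z), hw.2, ENNReal.ofReal_one]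

theorem weightMeasure_singleton {F : Type*} [Fintype F] [MeasurableSpace F]
    [MeasurableSingletonClass F] (w : F → ℝ) (z : F) :
    weightMeasure w {z} = ENNReal.ofReal (w z) := by
  classical
  simp [weightMeasure, Measure.coe_finsetSum, Set.indicator_apply]

theorem mul_mem_stdSimplex_of_rowStochastic {E : Type*} [Fintype E] [DecidableEq E]
    {D U : Matrix E E ℝ} (hD : D ∈ Matrix.rowStochastic ℝ E) (hU : U ∈ Matrix.rowStochastic ℝ E)
    (x : E) : (fun q : E × E => D x q.1 * U q.1 q.2) ∈ stdSimplex ℝ (E × E) := by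
  refine ⟨fun q => mul_nonneg (Matrix.nonneg_of_mem_rowStochastic hD)
    (Matrix.nonneg_of_mem_rowStochastic hU), ?_⟩
  rw [Fintype.sum_prod_type]
  simp only [← Finset.mul_sum, Matrix.sum_row_of_mem_rowStochastic hU, mul_one,
    Matrix.sum_row_of_mem_rowStochastic hD]

namespace Zigzag

section Path

variable {E : Type*}

/-- The upper line at nonnegative sites, built from the origin and the random maps `ω.2 (i, ·)`. -/
def forwardPath (ω : E × (ℤ × E → E × E)) : ℕ → E
  | 0 => ω.1
  | n + 1 => (ω.2 (Int.ofNat n, forwardPath ω n)).2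

/-- The upper line at nonpositive sites, built from the origin and the random maps `ω.2 (i, ·)`. -/
def backwardPath (ω : E × (ℤ × E → E × E)) : ℕ → E
  | 0 => ω.1
  | n + 1 => (ω.2 (Int.negSucc n, backwardPath ω n)).2

/-- The upper line. -/
def upperLine (ω : E × (ℤ × E → E × E)) : ℤ → E
  | Int.ofNat n => forwardPath ω n
  | Int.negSucc n => backwardPath ω (n + 1)

/-- The lower line. -/
def lowerLine (ω : E × (ℤ × E → E × E)) : ℤ → E
  | Int.ofNat n => (ω.2 (Int.ofNat n, forwardPath ω n)).1
  | Int.negSucc n => (ω.2 (Int.negSucc n, backwardPath ω n)).1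

/-- The state of the upper line from which the step at `i` starts. -/
def stepSource (x : ℤ → E) (i : ℤ) : E := if 0 ≤ i then x i else x (i + 1)

/-- The state of the upper line at which the step at `i` ends. -/
def stepTarget (x : ℤ → E) (i : ℤ) : E := if 0 ≤ i then x (i + 1) else x i

theorem step_eq (ω : E × (ℤ × E → E × E)) (i : ℤ) :
    ω.2 (i, stepSource (upperLine ω) i) = (lowerLine ω i, stepTarget (upperLine ω) i) := by
  cases i with
  | ofNat n =>
    have h : (0 : ℤ) ≤ Int.ofNat n := Int.natCast_nonneg n
    rw [stepSource, stepTarget, if_pos h, if_pos h]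
    rfl
  | negSucc n =>
    have h : ¬ (0 : ℤ) ≤ Int.negSucc n := by omega
    rw [stepSource, stepTarget, if_neg h, if_neg h]
    cases n <;> rfl

/-- Once the lines are prescribed, the source of each step is known, so the event fixes finitely
many coordinates of `ω` that do not themselves depend on `ω`. -/
theorem mem_zigzagCylinder_iff (ω : E × (ℤ × E → E × E)) (m n : ℕ) (x y : ℤ → E) :
    (upperLine ω, lowerLine ω) ∈ zigzagCylinder (-(m : ℤ)) n x y ↔
      ω.1 = x 0 ∧ ∀ i, -(m : ℤ) ≤ i → i ≤ n - 1 →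
        ω.2 (i, stepSource x i) = (y i, stepTarget x i) := by
  have h0 : upperLine ω 0 = ω.1 := rfl
  constructor
  · rintro ⟨h1, h2⟩
    refine ⟨by rw [← h0]; exact h1 0 (by omega) (by omega), fun i hi hi' => ?_⟩
    have h := step_eq ω i
    have e1 : stepSource (upperLine ω) i = stepSource x i := by
      unfold stepSource
      split_ifs
      · exact h1 _ (by omega) (by omega)
      · exact h1 _ (by omega) (by omega)
    have e2 : stepTarget (upperLine ω) i = stepTarget x i := by
      unfold stepTarget
      split_ifs
      · exact h1 _ (by omega) (by omega)
      · exact h1 _ (by omega) (by omega)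
    rwa [e1, e2, show lowerLine ω i = y i from h2 i hi hi'] at h
  · rintro ⟨h1, h2⟩
    have hf : ∀ k : ℕ, k ≤ n → upperLine ω k = x k := by
      intro k
      induction k with
      | zero => intro _; exact h1
      | succ k ih =>
        intro hk
        have a1 := step_eq ω k
        have a2 := h2 k (by omega) (by omega)
        have hk0 : (0 : ℤ) ≤ (k : ℤ) := by omega
        simp only [stepSource, stepTarget, if_pos hk0] at a1 a2
        rw [ih (by omega), a2] at a1
        push_cast
        exact (congrArg Prod.snd a1).symm
    have hb : ∀ k : ℕ, k ≤ m → upperLine ω (-(k : ℤ)) = x (-(k : ℤ)) := by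
      intro k
      induction k with
      | zero => intro _; exact h1
      | succ k ih =>
        intro hk
        have a1 := step_eq ω (-((k + 1 : ℕ) : ℤ))
        have a2 := h2 (-((k + 1 : ℕ) : ℤ)) (by omega) (by omega)
        have hk0 : ¬ (0 : ℤ) ≤ -((k + 1 : ℕ) : ℤ) := by omega
        simp only [stepSource, stepTarget, if_neg hk0] at a1 a2
        rw [show -((k + 1 : ℕ) : ℤ) + 1 = -(k : ℤ) by omega] at a1 a2
        rw [ih (by omega), a2] at a1
        exact (congrArg Prod.snd a1).symm
    have hx : ∀ i, -(m : ℤ) ≤ i → i ≤ n → upperLine ω i = x i := by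
      intro i hi hi'
      rcases le_total 0 i with h | h
      · have := hf i.toNat (by omega)
        rwa [Int.toNat_of_nonneg h] at this
      · have := hb (-i).toNat (by omega)
        rwa [Int.toNat_of_nonneg (by omega), neg_neg] at this
    refine ⟨hx, fun i hi hi' => ?_⟩
    have a1 := step_eq ω i
    have e1 : stepSource (upperLine ω) i = stepSource x i := by
      unfold stepSource
      split_ifs
      · exact hx _ (by omega) (by omega)
      · exact hx _ (by omega) (by omega)
    rw [e1, h2 i hi hi'] at a1
    exact (congrArg Prod.fst a1).symm

variable [Fintype E] [MeasurableSpace E] [DiscreteMeasurableSpace E]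

theorem measurable_eval (i : ℤ) {f : E × (ℤ × E → E × E) → E} (hf : Measurable f) :
    Measurable fun ω : E × (ℤ × E → E × E) => ω.2 (i, f ω) := by
  have h : Measurable fun q : (ℤ × E → E × E) × E => q.1 (i, q.2) :=
    measurable_from_prod_countable_left fun e => measurable_pi_apply (i, e)
  exact h.comp (measurable_snd.prodMk hf)

theorem measurable_forwardPath (n : ℕ) :
    Measurable fun ω : E × (ℤ × E → E × E) => forwardPath ω n := by
  induction n with
  | zero => exact measurable_fst
  | succ n ih => exact (measurable_eval _ ih).snd

theorem measurable_backwardPath (n : ℕ) :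
    Measurable fun ω : E × (ℤ × E → E × E) => backwardPath ω n := by
  induction n with
  | zero => exact measurable_fst
  | succ n ih => exact (measurable_eval _ ih).snd

theorem measurable_lines :
    Measurable fun ω : E × (ℤ × E → E × E) => (upperLine ω, lowerLine ω) := by
  refine Measurable.prodMk (measurable_pi_lambda _ fun i => ?_) (measurable_pi_lambda _ fun i => ?_)
  · cases i with
    | ofNat n => exact measurable_forwardPath n
    | negSucc n => exact measurable_backwardPath (n + 1)
  · cases i with
    | ofNat n => exact (measurable_eval _ (measurable_forwardPath n)).fst
    | negSucc n => exact (measurable_eval _ (measurable_backwardPath n)).fst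

end Path

section Law

variable {E : Type*} {D U : Matrix E E ℝ} {ρ : E → ℝ}

/-- The weights of the step at `i` from the state `e`. -/
def stepWeight (D U : Matrix E E ℝ) (j : ℤ × E) (q : E × E) : ℝ :=
  if 0 ≤ j.1 then D j.2 q.1 * U q.1 q.2 else U j.2 q.1 * D q.1 q.2

/-- Backward steps are drawn with `U` then `D`. Detailed balance reverses them one site at a time
and carries ρ from the origin to the left end. -/
theorem prod_stepWeight (hDρ : ∀ x y, ρ x * D x y = ρ y * D y x)
    (hUρ : ∀ x y, ρ x * U x y = ρ y * U y x) (m n : ℕ) (x y : ℤ → E) :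
    ρ (x 0) * ∏ i ∈ Finset.Icc (-(m : ℤ)) (n - 1),
        stepWeight D U (i, stepSource x i) (y i, stepTarget x i) =
      ρ (x (-(m : ℤ))) *
        ∏ i ∈ Finset.Icc (-(m : ℤ)) (n - 1), D (x i) (y i) * U (y i) (x (i + 1)) := by
  induction m with
  | zero =>
    simp only [Nat.cast_zero, neg_zero]
    congr 1
    refine Finset.prod_congr rfl fun i hi => ?_
    have h : 0 ≤ i := (Finset.mem_Icc.1 hi).1
    simp only [stepWeight, stepSource, stepTarget, if_pos h]
  | succ m ih =>
    have h : ¬ (0 : ℤ) ≤ -((m + 1 : ℕ) : ℤ) := by omega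
    have h1 : -((m + 1 : ℕ) : ℤ) + 1 = -(m : ℤ) := by omega
    rw [Finset.prod_Icc_int_left _ (a := -((m + 1 : ℕ) : ℤ)) (by omega),
      Finset.prod_Icc_int_left _ (a := -((m + 1 : ℕ) : ℤ)) (by omega), h1,
      mul_left_comm, ih]
    simp only [stepWeight, stepSource, stepTarget, if_neg h, h1]
    linear_combination (D (y (-((m + 1 : ℕ) : ℤ))) (x (-((m + 1 : ℕ) : ℤ))) *
      ∏ i ∈ Finset.Icc (-(m : ℤ)) (n - 1), D (x i) (y i) * U (y i) (x (i + 1))) *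
        hUρ (x (-(m : ℤ))) (y (-((m + 1 : ℕ) : ℤ))) +
      (U (y (-((m + 1 : ℕ) : ℤ))) (x (-(m : ℤ))) *
      ∏ i ∈ Finset.Icc (-(m : ℤ)) (n - 1), D (x i) (y i) * U (y i) (x (i + 1))) *
        hDρ (y (-((m + 1 : ℕ) : ℤ))) (x (-((m + 1 : ℕ) : ℤ)))

variable [Fintype E] [DecidableEq E]

theorem stepWeight_mem_stdSimplex (hD : D ∈ Matrix.rowStochastic ℝ E)
    (hU : U ∈ Matrix.rowStochastic ℝ E) (j : ℤ × E) : stepWeight D U j ∈ stdSimplex ℝ (E × E) := by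
  unfold stepWeight
  split_ifs
  · exact mul_mem_stdSimplex_of_rowStochastic hD hU _
  · exact mul_mem_stdSimplex_of_rowStochastic hU hD _

variable [MeasurableSpace E] [DiscreteMeasurableSpace E]

/-- The two lines are a deterministic function of independent data: a letter at the origin of law ρ,
and for each site and each source letter one random step. This needs only an infinite product
measure. The left half is grown outwards from the origin, which is where reversibility enters. -/
theorem exists_measure_centered (hD : D ∈ Matrix.rowStochastic ℝ E)
    (hU : U ∈ Matrix.rowStochastic ℝ E) (hρ : ρ ∈ stdSimplex ℝ E)
    (hDρ : ∀ x y, ρ x * D x y = ρ y * D y x) (hUρ : ∀ x y, ρ x * U x y = ρ y * U y x) :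
    ∃ μ : Measure ((ℤ → E) × (ℤ → E)), IsProbabilityMeasure μ ∧
      ∀ (m n : ℕ) (x y : ℤ → E), μ (zigzagCylinder (-(m : ℤ)) n x y) =
        ENNReal.ofReal (ρ (x (-(m : ℤ))) *
          ∏ j ∈ Finset.Icc (-(m : ℤ)) (n - 1), D (x j) (y j) * U (y j) (x (j + 1))) := by
  have hw := stepWeight_mem_stdSimplex hD hU
  have hp1 : IsProbabilityMeasure (weightMeasure ρ) := isProbabilityMeasure_weightMeasure hρ
  have hp2 : ∀ j, IsProbabilityMeasure (weightMeasure (stepWeight D U j)) := fun j =>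
    isProbabilityMeasure_weightMeasure (hw j)
  let P : Measure (E × (ℤ × E → E × E)) :=
    (weightMeasure ρ).prod (Measure.infinitePi fun j => weightMeasure (stepWeight D U j))
  refine ⟨P.map fun ω => (upperLine ω, lowerLine ω),
    Measure.isProbabilityMeasure_map measurable_lines.aemeasurable, fun m n x y => ?_⟩
  rw [Measure.map_apply measurable_lines (measurableSet_zigzagCylinder _ _ _ _)]
  have hset : (fun ω : E × (ℤ × E → E × E) => (upperLine ω, lowerLine ω)) ⁻¹'
      zigzagCylinder (-(m : ℤ)) n x y = {x 0} ×ˢ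
        ((((Finset.Icc (-(m : ℤ)) (n - 1)).image fun i => (i, stepSource x i) :
          Finset (ℤ × E)) : Set (ℤ × E)).pi fun j => {(y j.1, stepTarget x j.1)}) := by
    ext ω
    rw [Set.mem_preimage, mem_zigzagCylinder_iff]
    simp only [Set.mem_prod, Set.mem_singleton_iff, Set.mem_pi, Finset.coe_image, Finset.coe_Icc,
      Set.mem_image, Set.mem_Icc]
    refine and_congr_right fun _ => ⟨?_, fun h i h1 h2 => h _ ⟨i, ⟨h1, h2⟩, rfl⟩⟩
    rintro h _ ⟨i, ⟨h1, h2⟩, rfl⟩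
    exact h i h1 h2
  rw [hset, Measure.prod_prod, Measure.infinitePi_pi _ fun _ _ => measurableSet_singleton _,
    -- Distinct sites use distinct coordinates whatever the source letters, so their weights
    -- multiply.
    Finset.prod_image fun i _ j _ h => congrArg Prod.fst h]
  simp only [weightMeasure_singleton]
  rw [← ENNReal.ofReal_prod_of_nonneg fun i _ => (hw _).1 _, ← ENNReal.ofReal_mul (hρ.1 _),
    prod_stepWeight hDρ hUρ]

theorem measure_of_succ_right {μ : Measure ((ℤ → E) × (ℤ → E))}
    (hD : D ∈ Matrix.rowStochastic ℝ E) (hU : U ∈ Matrix.rowStochastic ℝ E)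
    (hρ : ρ ∈ stdSimplex ℝ E) {k₁ k₂ : ℤ} (hk : k₁ ≤ k₂)
    (h : ∀ x y, μ (zigzagCylinder k₁ (k₂ + 1) x y) = ENNReal.ofReal (ρ (x k₁) *
      ∏ j ∈ Finset.Icc k₁ k₂, D (x j) (y j) * U (y j) (x (j + 1)))) (x y : ℤ → E) :
    μ (zigzagCylinder k₁ k₂ x y) = ENNReal.ofReal (ρ (x k₁) *
      ∏ j ∈ Finset.Icc k₁ (k₂ - 1), D (x j) (y j) * U (y j) (x (j + 1))) := by
  let f : (ℤ → E) × (ℤ → E) → E × E := fun p => (p.2 k₂, p.1 (k₂ + 1))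
  have hf : Measurable f := by fun_prop
  have key : ∀ a : E × E, μ (f ⁻¹' {a} ∩ zigzagCylinder k₁ k₂ x y) =
      ENNReal.ofReal ((ρ (x k₁) * ∏ j ∈ Finset.Icc k₁ (k₂ - 1),
        D (x j) (y j) * U (y j) (x (j + 1))) * (D (x k₂) a.1 * U a.1 a.2)) := by
    intro a
    have hset : f ⁻¹' {a} ∩ zigzagCylinder k₁ k₂ x y =
        zigzagCylinder k₁ (k₂ + 1) (Function.update x (k₂ + 1) a.2) (Function.update y k₂ a.1) := by
      ext p
      simp only [f, zigzagCylinder, Set.mem_inter_iff, Set.mem_preimage,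
        Set.mem_singleton_iff, Set.mem_ofPred_eq, add_sub_cancel_right, Prod.ext_iff]
      constructor
      · rintro ⟨⟨h1, h2⟩, h3, h4⟩
        refine ⟨fun i hi hi' => ?_, fun i hi hi' => ?_⟩
        · rcases hi'.eq_or_lt with rfl | hi'
          · rw [Function.update_self, h2]
          · rw [Function.update_of_ne (by omega)]; exact h3 i hi (by omega)
        · rcases hi'.eq_or_lt with rfl | hi'
          · rw [Function.update_self, h1]
          · rw [Function.update_of_ne (by omega)]; exact h4 i hi (by omega)
      · rintro ⟨h1, h2⟩
        refine ⟨⟨?_, ?_⟩, fun i hi hi' => ?_, fun i hi hi' => ?_⟩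
        · rw [h2 _ hk le_rfl, Function.update_self]
        · rw [h1 _ (by omega) le_rfl, Function.update_self]
        · rw [h1 i hi (by omega), Function.update_of_ne (by omega)]
        · rw [h2 i hi (by omega), Function.update_of_ne (by omega)]
    rw [hset, h, Finset.prod_Icc_int_right _ hk, Function.update_self, Function.update_self,
      Function.update_of_ne (by omega), Function.update_of_ne (by omega), ← mul_assoc]
    congr 3
    refine Finset.prod_congr rfl fun j hj => ?_
    rw [Finset.mem_Icc] at hj
    rw [Function.update_of_ne (by omega), Function.update_of_ne (by omega),
      Function.update_of_ne (by omega)]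
  rw [measure_eq_sum_inter_preimage_singleton μ hf, Finset.sum_congr rfl fun a _ => key a,
    ← ENNReal.ofReal_sum_of_nonneg, ← Finset.mul_sum,
    (mul_mem_stdSimplex_of_rowStochastic hD hU (x k₂)).2, mul_one]
  exact fun a _ => mul_nonneg (mul_nonneg (hρ.1 _) (Finset.prod_nonneg fun j _ =>
    mul_nonneg (Matrix.nonneg_of_mem_rowStochastic hD) (Matrix.nonneg_of_mem_rowStochastic hU)))
    ((mul_mem_stdSimplex_of_rowStochastic hD hU (x k₂)).1 a)

/-- Here stationarity is needed: summing out the left end replaces ρ by ρDU. -/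
theorem measure_of_pred_left {μ : Measure ((ℤ → E) × (ℤ → E))}
    (hD : D ∈ Matrix.rowStochastic ℝ E) (hU : U ∈ Matrix.rowStochastic ℝ E)
    (hρ : ρ ∈ stdSimplex ℝ E) (hs : ∀ x', ∑ x, ρ x * ∑ y, D x y * U y x' = ρ x')
    {k₁ k₂ : ℤ} (hk : k₁ ≤ k₂)
    (h : ∀ x y, μ (zigzagCylinder (k₁ - 1) k₂ x y) = ENNReal.ofReal (ρ (x (k₁ - 1)) *
      ∏ j ∈ Finset.Icc (k₁ - 1) (k₂ - 1), D (x j) (y j) * U (y j) (x (j + 1)))) (x y : ℤ → E) :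
    μ (zigzagCylinder k₁ k₂ x y) = ENNReal.ofReal (ρ (x k₁) *
      ∏ j ∈ Finset.Icc k₁ (k₂ - 1), D (x j) (y j) * U (y j) (x (j + 1))) := by
  let f : (ℤ → E) × (ℤ → E) → E × E := fun p => (p.1 (k₁ - 1), p.2 (k₁ - 1))
  have hf : Measurable f := by fun_prop
  have key : ∀ a : E × E, μ (f ⁻¹' {a} ∩ zigzagCylinder k₁ k₂ x y) =
      ENNReal.ofReal ((ρ a.1 * (D a.1 a.2 * U a.2 (x k₁))) * ∏ j ∈ Finset.Icc k₁ (k₂ - 1),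
        D (x j) (y j) * U (y j) (x (j + 1))) := by
    intro a
    have hset : f ⁻¹' {a} ∩ zigzagCylinder k₁ k₂ x y = zigzagCylinder (k₁ - 1) k₂
        (Function.update x (k₁ - 1) a.1) (Function.update y (k₁ - 1) a.2) := by
      ext p
      simp only [f, zigzagCylinder, Set.mem_inter_iff, Set.mem_preimage,
        Set.mem_singleton_iff, Set.mem_ofPred_eq, Prod.ext_iff]
      constructor
      · rintro ⟨⟨h1, h2⟩, h3, h4⟩
        refine ⟨fun i hi hi' => ?_, fun i hi hi' => ?_⟩
        · rcases hi.eq_or_lt with rfl | hi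
          · rw [Function.update_self, h1]
          · rw [Function.update_of_ne (by omega)]; exact h3 i (by omega) hi'
        · rcases hi.eq_or_lt with rfl | hi
          · rw [Function.update_self, h2]
          · rw [Function.update_of_ne (by omega)]; exact h4 i (by omega) hi'
      · rintro ⟨h1, h2⟩
        refine ⟨⟨?_, ?_⟩, fun i hi hi' => ?_, fun i hi hi' => ?_⟩
        · rw [h1 _ le_rfl (by omega), Function.update_self]
        · rw [h2 _ le_rfl (by omega), Function.update_self]
        · rw [h1 i (by omega) hi', Function.update_of_ne (by omega)]
        · rw [h2 i (by omega) hi', Function.update_of_ne (by omega)]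
    rw [hset, h, Finset.prod_Icc_int_left _ (by omega), sub_add_cancel, Function.update_self,
      Function.update_self, Function.update_of_ne (by omega), ← mul_assoc]
    congr 2
    refine Finset.prod_congr rfl fun j hj => ?_
    rw [Finset.mem_Icc] at hj
    rw [Function.update_of_ne (by omega), Function.update_of_ne (by omega),
      Function.update_of_ne (by omega)]
  rw [measure_eq_sum_inter_preimage_singleton μ hf, Finset.sum_congr rfl fun a _ => key a,
    ← ENNReal.ofReal_sum_of_nonneg, ← Finset.sum_mul, Fintype.sum_prod_type, ← hs (x k₁)]
  · simp only [Finset.mul_sum]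
  exact fun a _ => mul_nonneg (mul_nonneg (hρ.1 _)
    (mul_nonneg (Matrix.nonneg_of_mem_rowStochastic hD) (Matrix.nonneg_of_mem_rowStochastic hU)))
    (Finset.prod_nonneg fun j _ =>
    mul_nonneg (Matrix.nonneg_of_mem_rowStochastic hD) (Matrix.nonneg_of_mem_rowStochastic hU))

theorem exists_measure (hD : D ∈ Matrix.rowStochastic ℝ E)
    (hU : U ∈ Matrix.rowStochastic ℝ E) (hρ : ρ ∈ stdSimplex ℝ E)
    (hDρ : ∀ x y, ρ x * D x y = ρ y * D y x) (hUρ : ∀ x y, ρ x * U x y = ρ y * U y x) :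
    ∃ μ : Measure ((ℤ → E) × (ℤ → E)), IsProbabilityMeasure μ ∧
      ∀ k₁ k₂ : ℤ, k₁ < k₂ → ∀ x y : ℤ → E, μ (zigzagCylinder k₁ k₂ x y) =
        ENNReal.ofReal (ρ (x k₁) *
          ∏ j ∈ Finset.Icc k₁ (k₂ - 1), D (x j) (y j) * U (y j) (x (j + 1))) := by
  obtain ⟨μ, hμ, hc⟩ := exists_measure_centered hD hU hρ hDρ hUρ
  have hs : ∀ x', ∑ x, ρ x * ∑ y, D x y * U y x' = ρ x' := by
    intro x'
    have : ∀ x, ρ x * ∑ y, D x y * U y x' = ∑ y, ρ x' * (U x' y * D y x) := by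
      intro x
      rw [Finset.mul_sum]
      refine Finset.sum_congr rfl fun y _ => ?_
      linear_combination U y x' * hDρ x y + D y x * hUρ y x'
    simp only [this]
    rw [Finset.sum_comm]
    simp only [← Finset.mul_sum, Matrix.sum_row_of_mem_rowStochastic hD, mul_one,
      Matrix.sum_row_of_mem_rowStochastic hU]
  refine ⟨μ, hμ, ?_⟩
  have hr : ∀ (d : ℕ) (k₁ k₂ : ℤ), k₁ ≤ k₂ →
      (∀ x y : ℤ → E, μ (zigzagCylinder k₁ (k₂ + d) x y) = ENNReal.ofReal (ρ (x k₁) *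
        ∏ j ∈ Finset.Icc k₁ (k₂ + d - 1), D (x j) (y j) * U (y j) (x (j + 1)))) →
      ∀ x y : ℤ → E, μ (zigzagCylinder k₁ k₂ x y) = ENNReal.ofReal (ρ (x k₁) *
        ∏ j ∈ Finset.Icc k₁ (k₂ - 1), D (x j) (y j) * U (y j) (x (j + 1))) := by
    intro d
    induction d with
    | zero => intro k₁ k₂ _ h; simpa using h
    | succ d ih =>
      intro k₁ k₂ hk h
      refine ih k₁ k₂ hk (measure_of_succ_right hD hU hρ (by omega) ?_)
      have e1 : k₂ + ((d + 1 : ℕ) : ℤ) = k₂ + d + 1 := by push_cast; ring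
      rwa [e1, add_sub_cancel_right] at h
  have hl : ∀ (d : ℕ) (k₁ k₂ : ℤ), k₁ ≤ k₂ →
      (∀ x y : ℤ → E, μ (zigzagCylinder (k₁ - d) k₂ x y) = ENNReal.ofReal (ρ (x (k₁ - d)) *
        ∏ j ∈ Finset.Icc (k₁ - d) (k₂ - 1), D (x j) (y j) * U (y j) (x (j + 1)))) →
      ∀ x y : ℤ → E, μ (zigzagCylinder k₁ k₂ x y) = ENNReal.ofReal (ρ (x k₁) *
        ∏ j ∈ Finset.Icc k₁ (k₂ - 1), D (x j) (y j) * U (y j) (x (j + 1))) := by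
    intro d
    induction d with
    | zero => intro k₁ k₂ _ h; simpa using h
    | succ d ih =>
      intro k₁ k₂ hk h
      refine ih k₁ k₂ hk (measure_of_pred_left hD hU hρ hs (by omega) ?_)
      have e1 : k₁ - ((d + 1 : ℕ) : ℤ) = k₁ - d - 1 := by push_cast; ring
      rwa [e1] at h
  intro k₁ k₂ hk
  -- Any window sits inside [-|k₁|, |k₂|], which contains the origin; the extra sites are then
  -- summed out on both sides.
  refine hl (k₁ + k₁.natAbs).toNat k₁ k₂ hk.le (hr (k₂.natAbs - k₂).toNat _ _ (by omega) ?_)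
  have h1 : k₁ - ((k₁ + k₁.natAbs).toNat : ℤ) = -(k₁.natAbs : ℤ) := by omega
  have h2 : k₂ + ((k₂.natAbs - k₂).toNat : ℤ) = (k₂.natAbs : ℤ) := by omega
  rw [h1, h2]
  exact hc _ _

end Law

end Zigzag

/-! ### Invariance and the local balance identity -/

section Invariance

variable {E : Type*} [Fintype E] [DecidableEq E] [MeasurableSpace E] [DiscreteMeasurableSpace E]
  {D U : Matrix E E ℝ} {μ : Measure ((ℤ → E) × (ℤ → E))}

theorem CondTPCA.mul_comm {E : Type*} [Fintype E] {A : TPCA E} {D U : Matrix E E ℝ}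
    (h : CondTPCA A D U) (y y' : E) : ∑ z, D y z * U z y' = ∑ z, U y z * D z y' := by
  rw [Finset.sum_congr rfl fun z _ => h y y' z, Finset.sum_comm]
  simp only [← Finset.mul_sum, A.sum_eq_one, mul_one]

theorem TPCA.invariant_of_condTPCA (A : TPCA E) [IsProbabilityMeasure μ] {ρ : E → ℝ}
    (hD : D ∈ Matrix.rowStochastic ℝ E) (hU : U ∈ Matrix.rowStochastic ℝ E)
    (hρ : ρ ∈ stdSimplex ℝ E) (hDρ : ∀ y, ∑ x, ρ x * D x y = ρ y) (hc : CondTPCA A D U)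
    (hμ : ∀ k₁ k₂ : ℤ, k₁ < k₂ → ∀ x y : ℤ → E, μ (zigzagCylinder k₁ k₂ x y) =
      ENNReal.ofReal (ρ (x k₁) *
        ∏ j ∈ Finset.Icc k₁ (k₂ - 1), D (x j) (y j) * U (y j) (x (j + 1)))) :
    A.step.Invariant μ := by
  have : IsProbabilityMeasure (μ.bind A.step) := inferInstance
  refine ext_of_zigzagCylinder fun k₁ k₂ hk y z => ?_
  rw [bind_step_zigzagCylinder (ρ := fun _ => ρ) hD hU (fun _ => hρ) hμ A hk.le, hμ k₁ k₂ hk, hDρ]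
  congr 2
  exact Finset.prod_congr rfl fun j _ => (hc _ _ _).symm

/-- Invariance tested on the window from `k` to `k + 1` alone. -/
theorem TPCA.local_balance_of_invariant (A : TPCA E) {ρ : ℤ → E → ℝ}
    (hD : D ∈ Matrix.rowStochastic ℝ E) (hU : U ∈ Matrix.rowStochastic ℝ E)
    (hρ : ∀ i, ρ i ∈ stdSimplex ℝ E)
    (hμ : ∀ k₁ k₂ : ℤ, k₁ < k₂ → ∀ x y : ℤ → E, μ (zigzagCylinder k₁ k₂ x y) =
      ENNReal.ofReal (ρ k₁ (x k₁) *
        ∏ j ∈ Finset.Icc k₁ (k₂ - 1), D (x j) (y j) * U (y j) (x (j + 1))))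
    (hI : A.step.Invariant μ) (k : ℤ) (y y' z : E) :
    (∑ a, ρ k a * D a y) * ∑ a, U y a * D a y' * A.T y a y' z = ρ k y * (D y z * U z y') := by
  have hDn := fun i j => Matrix.nonneg_of_mem_rowStochastic hD (i := i) (j := j)
  have hUn := fun i j => Matrix.nonneg_of_mem_rowStochastic hU (i := i) (j := j)
  have h := bind_step_zigzagCylinder hD hU hρ hμ A (k₁ := k) (k₂ := k + 1) (by omega)
    (fun i => if i = k then y else y') (fun _ => z)
  rw [Kernel.Invariant] at hI
  rw [hI, hμ _ _ (by omega)] at h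
  simp only [add_sub_cancel_right, Finset.Icc_self, Finset.prod_singleton, if_true,
    show k + 1 ≠ k by omega, if_false] at h
  rw [ENNReal.ofReal_eq_ofReal_iff] at h
  · exact h.symm
  · exact mul_nonneg ((hρ k).1 _) (mul_nonneg (hDn _ _) (hUn _ _))
  · exact mul_nonneg (Finset.sum_nonneg fun a _ => mul_nonneg ((hρ k).1 a) (hDn _ _))
      (Finset.sum_nonneg fun a _ =>
        mul_nonneg (mul_nonneg (hUn _ _) (hDn _ _)) (A.nonneg _ _ _ _))

theorem TPCA.PositiveRate.pos_of_hzmc_invariant {A : TPCA E} (hA : A.PositiveRate)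
    (hH : IsHZMC D U μ) (hI : A.step.Invariant μ) :
    (∀ x y, 0 < D x y) ∧ (∀ x y, 0 < U x y) ∧ CondTPCA A D U := by
  obtain ⟨-, hD, hU, ρ, hρ, hμ, -⟩ := hH
  have hDn := fun i j => Matrix.nonneg_of_mem_rowStochastic hD (i := i) (j := j)
  have hUn := fun i j => Matrix.nonneg_of_mem_rowStochastic hU (i := i) (j := j)
  have hDs := Matrix.sum_row_of_mem_rowStochastic hD
  have hUs := Matrix.sum_row_of_mem_rowStochastic hU
  have hb := A.local_balance_of_invariant hD hU hρ hμ hI 0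
  -- Summing the local balance over `y'` and `z` leaves ρD = ρ, since `T`, `D` and `U` all have row
  -- sums 1.
  have hst : ∀ y, ∑ a, ρ 0 a * D a y = ρ 0 y := by
    intro y
    have h1 : ∑ y', ∑ z, (∑ a, ρ 0 a * D a y) * ∑ a, U y a * D a y' * A.T y a y' z =
        ∑ y', ∑ z, ρ 0 y * (D y z * U z y') :=
      Finset.sum_congr rfl fun y' _ => Finset.sum_congr rfl fun z _ => hb y y' z
    have h2 : ∀ y', ∑ z, ∑ a, U y a * D a y' * A.T y a y' z = ∑ a, U y a * D a y' := by
      intro y'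
      rw [Finset.sum_comm]
      simp only [← Finset.mul_sum, A.sum_eq_one, mul_one]
    simp only [← Finset.mul_sum, h2] at h1
    rw [Finset.sum_comm] at h1
    nth_rewrite 2 [Finset.sum_comm] at h1
    simpa only [← Finset.mul_sum, hDs, hUs, mul_one] using h1
  have hc : ∀ y, 0 < ρ 0 y → ∀ y' z, D y z * U z y' = ∑ a, U y a * D a y' * A.T y a y' z := by
    intro y hy y' z
    have := hb y y' z
    rw [hst] at this
    exact (mul_left_cancel₀ hy.ne' this).symm
  have hex : ∀ (M : Matrix E E ℝ), (∀ i, ∑ j, M i j = 1) → ∀ x, ∃ y, 0 < M x y := by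
    intro M hM x
    by_contra! h
    have := Finset.sum_nonpos fun y (_ : y ∈ Finset.univ) => h y
    rw [hM] at this
    linarith
  -- By positive rate, a single nonzero term of the right-hand sum makes the left-hand product
  -- positive for every `z`.
  have hprop : ∀ y, 0 < ρ 0 y → ∀ a y', 0 < U y a → 0 < D a y' →
      ∀ z, 0 < D y z ∧ 0 < U z y' := by
    intro y hy a y' ha hy' z
    have h : 0 < D y z * U z y' := by
      rw [hc y hy]
      exact Finset.sum_pos' (fun b _ =>
          mul_nonneg (mul_nonneg (hUn _ _) (hDn _ _)) (A.nonneg _ _ _ _))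
        ⟨a, Finset.mem_univ _, mul_pos (mul_pos ha hy') (hA _ _ _ _)⟩
    exact ⟨pos_of_mul_pos_left h (hUn _ _), pos_of_mul_pos_right h (hDn _ _)⟩
  have hDrow : ∀ y, 0 < ρ 0 y → ∀ z, 0 < D y z := by
    intro y hy z
    obtain ⟨a, ha⟩ := hex U hUs y
    obtain ⟨y', hy'⟩ := hex D hDs a
    exact (hprop y hy a y' ha hy' z).1
  obtain ⟨y₀, hy₀⟩ : ∃ y, 0 < ρ 0 y := by
    by_contra! h
    have := Finset.sum_nonpos fun y (_ : y ∈ Finset.univ) => h y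
    rw [(hρ 0).2] at this
    linarith
  have hρp : ∀ z, 0 < ρ 0 z := by
    intro z
    rw [← hst]
    exact Finset.sum_pos' (fun a _ => mul_nonneg ((hρ 0).1 _) (hDn _ _))
      ⟨y₀, Finset.mem_univ _, mul_pos hy₀ (hDrow y₀ hy₀ z)⟩
  have hDp : ∀ x y, 0 < D x y := fun x => hDrow x (hρp x)
  refine ⟨hDp, fun z y' => ?_, fun y y' z => hc y (hρp y) y' z⟩
  obtain ⟨a, ha⟩ := hex U hUs y₀
  exact (hprop y₀ hy₀ a y' ha (hDp a y') z).2

end Invariance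

/-! ### Recovering T̃, ν and γ from `D` and `U` -/

section Algebra

open SquarePCA

variable {E : Type*} [Fintype E] {D U : Matrix E E ℝ}

/-- The vector is the conditional law of the letter between `y` and `y'` in the zigzag. The first
half-step, with neighbours reversed, sends D(y;x)U(x;y') to U(y;u)D(u;y') by `CondTPCA` combined
with reversibility; the second sends it back by `CondTPCA` itself. -/
theorem isStochasticLeftEigenvector_twoStep [Nonempty E] {A : TPCA E} {ρ : E → ℝ}
    (hρ : ∀ x, 0 < ρ x)
    (hDp : ∀ x y, 0 < D x y) (hUp : ∀ x y, 0 < U x y)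
    (hDρ : ∀ x y, ρ x * D x y = ρ y * D y x) (hUρ : ∀ x y, ρ x * U x y = ρ y * U y x)
    (hc : CondTPCA A D U) (y y' : E) :
    IsStochasticLeftEigenvector (A.twoStep y y') 1
      (fun x => D y x * U x y' / ∑ z, D y z * U z y') := by
  have hN : 0 < ∑ z, D y z * U z y' :=
    Finset.sum_pos (fun z _ => mul_pos (hDp _ _) (hUp _ _)) Finset.univ_nonempty
  refine ⟨⟨fun x => (div_pos (mul_pos (hDp _ _) (hUp _ _)) hN).le, ?_⟩, ?_⟩
  · rw [← Finset.sum_div, div_self hN.ne']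
  have h1 : ∀ y y' x, ρ y * (D y x * U x y') = ρ y' * (U y' x * D x y) := by
    intro y y' x
    linear_combination U x y' * hDρ y x + D x y * hUρ x y'
  have h2 : ∀ u, ∑ x, D y x * U x y' * A.T y' x y u = U y u * D u y' := by
    intro u
    have h3 : ρ y * ∑ x, D y x * U x y' * A.T y' x y u = ρ y * (U y u * D u y') := by
      rw [← h1 y' y u, hc y' y u, Finset.mul_sum, Finset.mul_sum]
      refine Finset.sum_congr rfl fun x _ => ?_
      linear_combination A.T y' x y u * h1 y y' x
    exact mul_left_cancel₀ (hρ y).ne' h3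
  funext z
  simp only [Matrix.vecMul, dotProduct, TPCA.twoStep, Matrix.of_apply, one_smul]
  rw [hc y y' z]
  simp only [div_mul_eq_mul_div, ← Finset.sum_div]
  congr 1
  simp only [Finset.mul_sum]
  rw [Finset.sum_comm]
  refine Finset.sum_congr rfl fun u _ => ?_
  rw [← h2 u, Finset.sum_mul]
  exact Finset.sum_congr rfl fun x _ => by ring

theorem condOne_of_eq_div [Zero E] {T : E → E → E → ℝ}
    (hT : ∀ x x' y, T x x' y = D x y * U y x' / ∑ z, D x z * U z x') : CondOne T := by
  intro x x' y
  simp only [hT]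
  rw [div_mul_div_comm, div_mul_div_comm, div_mul_div_comm, div_mul_div_comm, div_mul_div_comm,
    div_mul_div_comm]
  congr 1 <;> ring

variable {T : E → E → E → ℝ} (hDp : ∀ x y, 0 < D x y) (hUp : ∀ x y, 0 < U x y)
  (hT : ∀ x x' y, T x x' y = D x y * U y x' / ∑ z, D x z * U z x')

include hDp hUp

theorem sum_mul_pos [Nonempty E] (x x' : E) : 0 < ∑ z, D x z * U z x' :=
  Finset.sum_pos (fun _ _ => mul_pos (hDp _ _) (hUp _ _)) Finset.univ_nonempty

include hT

/-- In the ratio T(0,x';y)/T(0,x';0) both the normalisation and U(0;x') cancel, leaving U(y;x') up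
to a factor free of x'. -/
theorem matU_eq [Zero E] (hUs : ∀ x, ∑ y, U x y = 1) : matU T (U 0) = U := by
  have hN := fun x x' => (sum_mul_pos hDp hUp x x').ne'
  have h : ∀ y x', U 0 x' * (T 0 x' y / T 0 x' 0) = D 0 y / D 0 0 * U y x' := by
    intro y x'
    have := hN 0 x'
    have := (hDp 0 0).ne'
    have := (hUp 0 x').ne'
    rw [hT, hT]
    field_simp
  ext y x'
  simp only [matU, Matrix.of_apply, h, ← Finset.mul_sum, hUs]
  rw [mul_one, mul_div_cancel_left₀]
  exact (div_pos (hDp _ _) (hDp _ _)).ne'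

theorem matD_eq [Zero E] (hDs : ∀ x, ∑ y, D x y = 1) (hUs : ∀ x, ∑ y, U x y = 1) :
    matD T (U 0) = D := by
  have hN := fun x x' => (sum_mul_pos hDp hUp x x').ne'
  have h : ∀ x y x', U 0 x' * (T x x' y / T x x' 0) = D x y / D x 0 * U y x' := by
    intro x y x'
    have := hN x x'
    have := (hDp x 0).ne'
    have := (hUp 0 x').ne'
    rw [hT, hT]
    field_simp
  have h' : ∀ x x', U 0 x' / T x x' 0 = (D x 0)⁻¹ * ∑ z, D x z * U z x' := by
    intro x x'
    have := hN x x'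
    have := (hDp x 0).ne'
    have := (hUp 0 x').ne'
    rw [hT]
    field_simp
  ext x y
  simp only [matD, Matrix.of_apply, h, h', ← Finset.mul_sum, hUs]
  rw [Finset.sum_comm]
  simp only [← Finset.mul_sum, hUs, mul_one, hDs]
  have := (hDp x 0).ne'
  field_simp

theorem isStochasticLeftEigenvector_diagMatrix [Nonempty E]
    (hcomm : ∀ x y, ∑ z, D x z * U z y = ∑ z, U x z * D z y) :
    IsStochasticLeftEigenvector (diagMatrix T) 1
      (fun x => (∑ z, D x z * U z x) / ∑ y, ∑ z, D y z * U z y) := by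
  have hN := sum_mul_pos hDp hUp
  have htr : 0 < ∑ y, ∑ z, D y z * U z y :=
    Finset.sum_pos (fun y _ => hN y y) Finset.univ_nonempty
  refine ⟨⟨fun x => (div_pos (hN _ _) htr).le, ?_⟩, ?_⟩
  · rw [← Finset.sum_div, div_self htr.ne']
  funext y
  simp only [Matrix.vecMul, dotProduct, diagMatrix, Matrix.of_apply, one_smul, hT]
  have h : ∀ x, (∑ z, D x z * U z x) / (∑ y, ∑ z, D y z * U z y) *
      (D x y * U y x / ∑ z, D x z * U z x) = U y x * D x y / ∑ y, ∑ z, D y z * U z y := by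
    intro x
    have := (hN x x).ne'
    have := htr.ne'
    field_simp
  simp only [h, ← Finset.sum_div]
  rw [hcomm y y]

/-- After cancellation the sum over `x` is a row sum of DU, equal to 1, so only U(0;y) divided by
the trace of DU survives. -/
theorem isStochasticLeftEigenvector_gammaMatrix [Zero E] (hDs : ∀ x, ∑ y, D x y = 1)
    (hUs : ∀ x, ∑ y, U x y = 1) :
    IsStochasticLeftEigenvector
      (gammaMatrix T fun x => (∑ z, D x z * U z x) / ∑ y, ∑ z, D y z * U z y)
      (∑ y, ∑ z, D y z * U z y)⁻¹ (U 0) := by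
  have hN := sum_mul_pos hDp hUp
  have htr : 0 < ∑ y, ∑ z, D y z * U z y :=
    Finset.sum_pos (fun y _ => hN y y) Finset.univ_nonempty
  refine ⟨⟨fun x => (hUp _ _).le, hUs 0⟩, ?_⟩
  funext y
  simp only [Matrix.vecMul, dotProduct, gammaMatrix, Matrix.of_apply, hT, Pi.smul_apply,
    smul_eq_mul]
  have h : ∀ x, U 0 x * ((∑ z, D y z * U z y) / (∑ y, ∑ z, D y z * U z y) *
      (D y 0 * U 0 y / (∑ z, D y z * U z y) / (D y 0 * U 0 x / ∑ z, D y z * U z x))) =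
      (∑ y, ∑ z, D y z * U z y)⁻¹ * U 0 y * ∑ z, D y z * U z x := by
    intro x
    have := (hN y x).ne'
    have := (hN y y).ne'
    have := htr.ne'
    have := (hUp 0 x).ne'
    have := (hDp y 0).ne'
    field_simp
  have hrow : ∑ x, ∑ z, D y z * U z x = 1 := by
    rw [Finset.sum_comm]
    simp only [← Finset.mul_sum, hUs, mul_one, hDs]
  simp only [h, ← Finset.mul_sum, hrow, mul_one]

end Algebra

/-! ### Positivity and stochasticity of `matD` and `matU` -/

section Stochastic

open SquarePCA

variable {E : Type*} [Fintype E] [Zero E] {T : E → E → E → ℝ} {η : E → ℝ}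

theorem matD_pos (hT : ∀ x x' y, 0 < T x x' y) (hη : ∀ x, 0 < η x) (x y : E) :
    0 < matD T η x y :=
  div_pos (Finset.sum_pos (fun _ _ => mul_pos (hη _) (div_pos (hT _ _ _) (hT _ _ _)))
    Finset.univ_nonempty)
    (Finset.sum_pos (fun _ _ => div_pos (hη _) (hT _ _ _)) Finset.univ_nonempty)

theorem matU_pos (hT : ∀ x x' y, 0 < T x x' y) (hη : ∀ x, 0 < η x) (x y : E) :
    0 < matU T η x y :=
  div_pos (mul_pos (hη _) (div_pos (hT _ _ _) (hT _ _ _)))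
    (Finset.sum_pos (fun _ _ => mul_pos (hη _) (div_pos (hT _ _ _) (hT _ _ _)))
      Finset.univ_nonempty)

variable [DecidableEq E]

theorem matD_mem_rowStochastic (hT : ∀ x x' y, 0 < T x x' y) (hTs : ∀ x x', ∑ y, T x x' y = 1)
    (hη : ∀ x, 0 < η x) : matD T η ∈ Matrix.rowStochastic ℝ E := by
  rw [Matrix.mem_rowStochastic_iff_sum]
  refine ⟨fun x y => (matD_pos hT hη x y).le, fun x => ?_⟩
  have h : 0 < ∑ x'', η x'' / T x x'' 0 :=
    Finset.sum_pos (fun _ _ => div_pos (hη _) (hT _ _ _)) Finset.univ_nonempty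
  simp only [matD, Matrix.of_apply]
  rw [← Finset.sum_div, div_eq_one_iff_eq h.ne', Finset.sum_comm]
  refine Finset.sum_congr rfl fun x' _ => ?_
  rw [← Finset.mul_sum, ← Finset.sum_div, hTs, mul_one_div]

theorem matU_mem_rowStochastic (hT : ∀ x x' y, 0 < T x x' y) (hη : ∀ x, 0 < η x) :
    matU T η ∈ Matrix.rowStochastic ℝ E := by
  rw [Matrix.mem_rowStochastic_iff_sum]
  refine ⟨fun x y => (matU_pos hT hη x y).le, fun y => ?_⟩
  simp only [matU, Matrix.of_apply]
  rw [← Finset.sum_div, div_self]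
  exact (Finset.sum_pos (fun _ _ => mul_pos (hη _) (div_pos (hT _ _ _) (hT _ _ _)))
      Finset.univ_nonempty).ne'

end Stochastic

/-! ### Reversibility and uniqueness on two letters -/

section FinTwo

variable {D U : Matrix (Fin 2) (Fin 2) ℝ}

/-- With two states, stationarity says that the flows across the only cut agree. -/
theorem reversible_fin_two {M : Matrix (Fin 2) (Fin 2) ℝ} {ρ : Fin 2 → ℝ}
    (hM : ∀ x, ∑ y, M x y = 1) (h : ∀ y, ∑ x, ρ x * M x y = ρ y) (x y : Fin 2) :
    ρ x * M x y = ρ y * M y x := by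
  have h0 := h 0
  have m0 := hM 0
  rw [Fin.sum_univ_two] at h0 m0
  have : ρ 0 * M 0 1 = ρ 1 * M 1 0 := by linear_combination ρ 0 * m0 - h0
  fin_cases x <;> fin_cases y
  · rfl
  · exact this
  · exact this.symm
  · rfl

/-- If ρ is stationary for `D`, commutation makes ρU stationary for `D` too, and uniqueness gives ρU
= ρ. -/
theorem exists_common_reversible_fin_two (hDp : ∀ x y, 0 < D x y)
    (hDs : ∀ x, ∑ y, D x y = 1) (hUs : ∀ x, ∑ y, U x y = 1) (hUp : ∀ x y, 0 < U x y)
    (hcomm : ∀ x y, ∑ z, D x z * U z y = ∑ z, U x z * D z y) :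
    ∃ ρ : Fin 2 → ℝ, (∀ x, 0 < ρ x) ∧ ρ ∈ stdSimplex ℝ (Fin 2) ∧
      (∀ x y, ρ x * D x y = ρ y * D y x) ∧ ∀ x y, ρ x * U x y = ρ y * U y x := by
  obtain ⟨ρ, hρ, ⟨hρs, hE⟩, huniq⟩ := exists_stationary_fin_two D hDp hDs
  rw [one_smul] at hE
  have hDU : D * U = U * D := by
    ext x y
    simp only [Matrix.mul_apply, hcomm]
  have hUst : Matrix.vecMul ρ U = ρ := by
    refine huniq _ ⟨⟨fun y => ?_, ?_⟩, ?_⟩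
    · change 0 ≤ ∑ x, ρ x * U x y
      exact Finset.sum_nonneg fun x _ => mul_nonneg (hρ x).le (hUp x y).le
    · simp only [Matrix.vecMul, dotProduct]
      rw [Finset.sum_comm]
      simp only [← Finset.mul_sum, hUs, mul_one, hρs.2]
    · rw [one_smul, Matrix.vecMul_vecMul, ← hDU, ← Matrix.vecMul_vecMul, hE]
  exact ⟨ρ, hρ, hρs, reversible_fin_two hDs fun y => congrFun hE y,
    reversible_fin_two hUs fun y => congrFun hUst y⟩

/-- One step multiplies the difference of the first coordinates by M 0 0 - M 1 0, of modulus less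
than 1. These differences are bounded by 1 arbitrarily far to the left, so they vanish. -/
theorem eq_of_recursion_fin_two {M : Matrix (Fin 2) (Fin 2) ℝ} (hM : ∀ x y, 0 < M x y)
    (hMs : ∀ x, ∑ y, M x y = 1) {ρ σ : ℤ → Fin 2 → ℝ} (hρ : ∀ i, ρ i ∈ stdSimplex ℝ (Fin 2))
    (hσ : ∀ i, σ i ∈ stdSimplex ℝ (Fin 2)) (hρM : ∀ i y, ρ (i + 1) y = ∑ x, ρ i x * M x y)
    (hσM : ∀ i y, σ (i + 1) y = ∑ x, σ i x * M x y) : ρ = σ := by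
  have hs : ∀ v : Fin 2 → ℝ, v ∈ stdSimplex ℝ (Fin 2) → v 0 + v 1 = 1 := fun v hv => by
    rw [← Fin.sum_univ_two]; exact hv.2
  have m0 := hMs 0
  have m1 := hMs 1
  rw [Fin.sum_univ_two] at m0 m1
  have hM00 := hM 0 0
  have hM01 := hM 0 1
  have hM10 := hM 1 0
  have hM11 := hM 1 1
  have hθ : |M 0 0 - M 1 0| < 1 := by rw [abs_lt]; constructor <;> linarith
  have hstep : ∀ i, ρ (i + 1) 0 - σ (i + 1) 0 = (M 0 0 - M 1 0) * (ρ i 0 - σ i 0) := by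
    intro i
    rw [hρM, hσM, Fin.sum_univ_two, Fin.sum_univ_two]
    linear_combination M 1 0 * hs _ (hρ i) - M 1 0 * hs _ (hσ i)
  have hiter : ∀ (n : ℕ) (i : ℤ), ρ i 0 - σ i 0 =
      (M 0 0 - M 1 0) ^ n * (ρ (i - n) 0 - σ (i - n) 0) := by
    intro n
    induction n with
    | zero => simp
    | succ n ih =>
      intro i
      have := hstep (i - (n + 1 : ℕ))
      rw [show i - ((n + 1 : ℕ) : ℤ) + 1 = i - n by push_cast; ring] at this
      rw [ih i, this, pow_succ, mul_assoc]
  have hbd : ∀ i, |ρ i 0 - σ i 0| ≤ 1 := by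
    intro i
    have h1 := hs _ (hρ i)
    have h2 := hs _ (hσ i)
    have := (hρ i).1 0
    have := (hρ i).1 1
    have := (hσ i).1 0
    have := (hσ i).1 1
    rw [abs_le]; constructor <;> linarith
  have hzero : ∀ i, ρ i 0 = σ i 0 := by
    intro i
    have hle : ∀ n : ℕ, |ρ i 0 - σ i 0| ≤ |M 0 0 - M 1 0| ^ n := by
      intro n
      rw [hiter n i, abs_mul, abs_pow]
      exact mul_le_of_le_one_right (by positivity) (hbd _)
    have := ge_of_tendsto' (tendsto_pow_atTop_nhds_zero_of_lt_one (abs_nonneg _) hθ) hle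
    have := abs_nonpos_iff.1 this
    linarith
  funext i x
  fin_cases x
  · exact hzero i
  · have h1 := hs _ (hρ i)
    have h2 := hs _ (hσ i)
    have h3 := hzero i
    change ρ i 1 = σ i 1
    linarith

theorem IsHZMC.measure_zigzagCylinder {μ : Measure ((ℤ → Fin 2) × (ℤ → Fin 2))}
    (hH : IsHZMC D U μ) (hDp : ∀ x y, 0 < D x y) (hUp : ∀ x y, 0 < U x y) {ρ : Fin 2 → ℝ}
    (hρ : ρ ∈ stdSimplex ℝ (Fin 2)) (hρs : ∀ x', ∑ x, ρ x * ∑ y, D x y * U y x' = ρ x')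
    (k₁ k₂ : ℤ) (hk : k₁ < k₂) (x y : ℤ → Fin 2) : μ (zigzagCylinder k₁ k₂ x y) =
      ENNReal.ofReal (ρ (x k₁) *
        ∏ j ∈ Finset.Icc k₁ (k₂ - 1), D (x j) (y j) * U (y j) (x (j + 1))) := by
  obtain ⟨-, hD, hU, σ, hσ, hμ, hσM⟩ := hH
  have hDU := mul_mem hD hU
  have hpos : ∀ x y, 0 < (D * U) x y := sum_mul_pos hDp hUp
  have : σ = fun _ => ρ := eq_of_recursion_fin_two (M := D * U) hpos
    (Matrix.sum_row_of_mem_rowStochastic hDU) hσ (fun _ => hρ)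
    hσM fun _ y => (hρs y).symm
  subst this
  exact hμ k₁ k₂ hk x y

end FinTwo

/-! ### The characterisation -/

theorem mainTheorem11 (A : TPCA (Fin 2)) (hA : A.PositiveRate) :
    ∃ (Tt : Fin 2 → Fin 2 → Fin 2 → ℝ) (γ : Fin 2 → ℝ),
      (∀ y y', IsTheStochasticLeftEigenvector (A.twoStep y y') 1 (Tt y y')) ∧
      SquarePCA.IsGamma Tt γ ∧
      ((∃ (D U : Matrix (Fin 2) (Fin 2) ℝ) (μ : Measure ((ℤ → Fin 2) × (ℤ → Fin 2))),
          IsHZMC D U μ ∧ A.IsInvariantProbability μ) ↔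
        SquarePCA.CondOne Tt ∧
          CondTPCA A (SquarePCA.matD Tt γ) (SquarePCA.matU Tt γ)) ∧
      (SquarePCA.CondOne Tt ∧ CondTPCA A (SquarePCA.matD Tt γ) (SquarePCA.matU Tt γ) →
        (∃! μ : Measure ((ℤ → Fin 2) × (ℤ → Fin 2)),
          IsHZMC (SquarePCA.matD Tt γ) (SquarePCA.matU Tt γ) μ) ∧
        ∀ μ : Measure ((ℤ → Fin 2) × (ℤ → Fin 2)),
          IsHZMC (SquarePCA.matD Tt γ) (SquarePCA.matU Tt γ) μ → A.IsInvariantProbability μ) := by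
  have htwo : ∀ y y', ∃ v : Fin 2 → ℝ, (∀ i, 0 < v i) ∧
      IsTheStochasticLeftEigenvector (A.twoStep y y') 1 v := by
    intro y y'
    refine exists_stationary_fin_two _ (fun x z => ?_) (fun x => ?_)
    · exact Finset.sum_pos (fun u _ => mul_pos (hA y' x y u) (hA y u y' z)) Finset.univ_nonempty
    · simp only [TPCA.twoStep, Matrix.of_apply]
      rw [Finset.sum_comm]
      simp only [← Finset.mul_sum, A.sum_eq_one, mul_one]
  choose Tt hTp hTt using htwo
  have hTs : ∀ x x', ∑ y, Tt x x' y = 1 := fun x x' => (hTt x x').1.1.2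
  obtain ⟨ν, hνp, hν⟩ := exists_stationary_fin_two (SquarePCA.diagMatrix Tt)
    (fun x y => hTp x x y) (fun x => hTs x x)
  obtain ⟨lam, γ, hlam, hγp, hγ, hγu⟩ := exists_perron_fin_two (SquarePCA.gammaMatrix Tt ν)
    (fun x y => mul_pos (hνp y) (div_pos (hTp _ _ _) (hTp _ _ _)))
  have hback : CondTPCA A (SquarePCA.matD Tt γ) (SquarePCA.matU Tt γ) →
      (∃! μ : Measure ((ℤ → Fin 2) × (ℤ → Fin 2)),
        IsHZMC (SquarePCA.matD Tt γ) (SquarePCA.matU Tt γ) μ) ∧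
      ∀ μ : Measure ((ℤ → Fin 2) × (ℤ → Fin 2)),
        IsHZMC (SquarePCA.matD Tt γ) (SquarePCA.matU Tt γ) μ → A.IsInvariantProbability μ := by
    intro hc
    have hDp := matD_pos hTp hγp
    have hUp := matU_pos hTp hγp
    have hD := matD_mem_rowStochastic hTp hTs hγp
    have hU := matU_mem_rowStochastic hTp hγp
    have hDs := Matrix.sum_row_of_mem_rowStochastic hD
    have hUs := Matrix.sum_row_of_mem_rowStochastic hU
    obtain ⟨ρ, -, hρ, hDρ, hUρ⟩ := exists_common_reversible_fin_two hDp hDs hUs hUp hc.mul_comm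
    have hstD : ∀ y, ∑ x, ρ x * SquarePCA.matD Tt γ x y = ρ y := by
      intro y
      simp only [fun x => hDρ x y, ← Finset.mul_sum, hDs, mul_one]
    have hstU : ∀ y, ∑ x, ρ x * SquarePCA.matU Tt γ x y = ρ y := by
      intro y
      simp only [fun x => hUρ x y, ← Finset.mul_sum, hUs, mul_one]
    have hst : ∀ x', ∑ x, ρ x * ∑ y, SquarePCA.matD Tt γ x y * SquarePCA.matU Tt γ y x' = ρ x' := by
      intro x'
      simp only [Finset.mul_sum]
      rw [Finset.sum_comm]
      simp only [← mul_assoc, ← Finset.sum_mul, hstD, hstU]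
    obtain ⟨μ, hμ, hcyl⟩ := Zigzag.exists_measure hD hU hρ hDρ hUρ
    refine ⟨⟨μ, ⟨hμ, hD, hU, fun _ => ρ, fun _ => hρ, hcyl, fun _ x' => (hst x').symm⟩, ?_⟩, ?_⟩
    · intro μ' h'
      have := h'.1
      refine ext_of_zigzagCylinder fun k₁ k₂ hk x y => ?_
      rw [hcyl k₁ k₂ hk, h'.measure_zigzagCylinder hDp hUp hρ hst k₁ k₂ hk]
    · intro μ' h'
      have := h'.1
      exact ⟨h'.1, A.invariant_of_condTPCA hD hU hρ hstD hc
        (h'.measure_zigzagCylinder hDp hUp hρ hst)⟩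
  refine ⟨Tt, γ, hTt, ⟨ν, lam, hν, hlam, hγ, fun w hw => (hγu _ w hw).2⟩, ⟨?_, ?_⟩,
    fun h => hback h.2⟩
  · rintro ⟨D, U, μ, hH, -, hI⟩
    obtain ⟨hDp, hUp, hc⟩ := hA.pos_of_hzmc_invariant hH hI
    have hDs := Matrix.sum_row_of_mem_rowStochastic hH.2.1
    have hUs := Matrix.sum_row_of_mem_rowStochastic hH.2.2.1
    obtain ⟨ρ, hρp, -, hDρ, hUρ⟩ := exists_common_reversible_fin_two hDp hDs hUs hUp hc.mul_comm
    have hT : ∀ x x' y, Tt x x' y = D x y * U y x' / ∑ z, D x z * U z x' := fun x x' y =>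
      (congrFun ((hTt x x').2 _
        (isStochasticLeftEigenvector_twoStep hρp hDp hUp hDρ hUρ hc x x')) y).symm
    have hνeq := hν.2 _ (isStochasticLeftEigenvector_diagMatrix hDp hUp hT hc.mul_comm)
    -- Perron uniqueness over all eigenvalues identifies γ without comparing 1/tr(DU) with `lam`
    -- beforehand.
    have hγeq : U 0 = γ := by
      rw [← hνeq] at hγu
      exact (hγu _ _ (isStochasticLeftEigenvector_gammaMatrix hDp hUp hT hDs hUs)).2
    rw [← hγeq, matD_eq hDp hUp hT hDs hUs, matU_eq hDp hUp hT hUs]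
    exact ⟨condOne_of_eq_div hT, hc⟩
  · rintro ⟨-, hc⟩
    obtain ⟨⟨μ, hμ, -⟩, hinv⟩ := hback hc
    exact ⟨_, _, μ, hμ, hinv μ hμ⟩

end
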